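/- Let $k$ be an algebraically closed field. A \emph{curve} in $\mathbb{P}^3=\mathbb{P}^3_k$ is a locally Cohen--Macaulay, purely one-dimensional closed subscheme; its degree $\deg C$ and arithmetic genus $g(C)$ are defined by $\chi(\mathcal{O}_C(n)) = n\deg C+1-g(C)$. A \emph{$d$-uple line} is a curve $C$ of degree $d$ whose support is a line $L$. Such a $C$ is \emph{quasiprimitive} if it has embedding dimension two at all but finitely many points of $L$, and \emph{primitive} if it has embedding dimension two at every point of $L$. Let $C_j$ be the subscheme obtained from $C\cap L_j$ by removing its embedded points, where $L_j$ is defined by $\mathcal{I}_L^j$, and put $\mathcal{L}_j=\mathcal{I}_{C_j}/\mathcal{I}_{C_{j+1}}$. If $C$ is quasiprimitive, then $\mathcal{L}_1,\dots,\mathcal{L}_{d-1}$ are line bundles on $L$, and the generically surjective multiplication maps $\mathcal{L}_1^{\otimes j}\to\mathcal{L}_j$ define effective divisors $D_j$ on $L$ with $\mathcal{L}_j\cong\mathcal{L}_1^{\otimes j}(D_j)$; the \emph{type} of $C$ is $(a;b_2,\dots,b_{d-1})$, where $a=\deg\mathcal{L}_1$ and $b_j=\deg D_j$. For integers $d\ge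 1$ and $\ell\ge 0$, a $d$-uple line $C$ with support $L$ is called a $C_{d,\ell}$ if $$g(C)=-(d-1)-\binom d3-\ell\binom d2 \quad\text{and}\quad H^0\big(\mathcal{I}_C(\ell+d-1)\big)=H^0\big(\mathcal{I}_L^d(\ell+d-1)\big).$$ \textbf{Proposition.} Suppose $d\ge 2$, $\ell\ge 0$ and $C$ is a $C_{d,\ell}$. Then $C$ is quasiprimitive. If $(a;b_2,\dots,b_{d-1})$ is the type of $C$, then $$\ell\le a\le \ell+\Big\lfloor\frac{d-2}3\Big\rfloor \qquad\text{and}\qquad \sum_{j=2}^{d-1}b_j+(a-\ell)\binom d2=\binom d3 .$$ In particular, if $C$ is primitive, then $d\equiv 2 \pmod 3$ and $a=\ell+\frac{d-2}3$. -/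

import Mathlib

open MvPolynomial AlgebraicGeometry Filter
open scoped LinearAlgebra.Projectivization

attribute [local instance] MvPolynomial.gradedAlgebra

universe u

noncomputable section

namespace SpaceCurve

variable (k : Type u) [Field k]

/-- The homogeneous coordinate ring `k[x₀, x₁, x₂, x₃]` of projective three-space. -/
abbrev S : Type u := MvPolynomial (Fin 4) k

/-- The projective space `ℙ³` over `k`, as a scheme. -/
abbrev P3 : Scheme.{u} := Proj (homogeneousSubmodule (Fin 4) k)

theorem X_mem (i : Fin 4) : (X i : S k) ∈ homogeneousSubmodule (Fin 4) k 1 :=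
  (mem_homogeneousSubmodule 1 _).2 (isHomogeneous_X k i)

theorem mem_smul_one {n : ℕ} {f : S k} (hf : f ∈ homogeneousSubmodule (Fin 4) k n) :
    f ∈ homogeneousSubmodule (Fin 4) k (n • 1) := by
  rwa [smul_eq_mul, mul_one]

/-- The standard affine open `D₊(xᵢ)` of `ℙ³`. -/
abbrev chart (i : Fin 4) : (P3 k).affineOpens :=
  ⟨Proj.basicOpen (homogeneousSubmodule (Fin 4) k) (X i),
    Proj.isAffineOpen_basicOpen (homogeneousSubmodule (Fin 4) k) (X i)
      (X_mem k i) Nat.one_pos⟩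

variable {k}

/-- For a form `f` of degree `n`, the regular function `f / xᵢⁿ` on `D₊(xᵢ)`. -/
def dehomogenize (i : Fin 4) (n : ℕ) (f : S k) (hf : f ∈ homogeneousSubmodule (Fin 4) k n) :
    Γ(P3 k, (chart k i).1) :=
  (Proj.awayToSection (homogeneousSubmodule (Fin 4) k) (X i)).hom
    (HomogeneousLocalization.Away.mk (homogeneousSubmodule (Fin 4) k) (X_mem k i) n f
      (mem_smul_one k hf))

/-! Closed subschemes `C` of `ℙ³` are given by their (quasi-coherent) ideal sheaves. -/

/-- The (saturated) homogeneous ideal `I_C = ⨁ₙ H⁰(ℐ_C(n))` of a closed subscheme `C` of `ℙ³`: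
a form `f` of degree `n` is a section of `ℐ_C(n)` iff on each `D₊(xᵢ)` the function `f / xᵢⁿ` is a
section of the ideal sheaf `ℐ_C`. -/
def homIdeal (C : (P3 k).IdealSheafData) : Ideal (S k) :=
  Ideal.span {f | ∃ (n : ℕ) (hf : f ∈ homogeneousSubmodule (Fin 4) k n),
    ∀ i : Fin 4, dehomogenize i n f hf ∈ C.ideal (chart k i)}

/-- The degree `n` part of a homogeneous ideal. -/
def piece (I : Ideal (S k)) (n : ℕ) : Submodule k (S k) :=
  I.restrictScalars k ⊓ homogeneousSubmodule (Fin 4) k n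

/-- `dim_k (J / I)ₙ` for homogeneous ideals `I ≤ J`. -/
def gradedDim (J I : Ideal (S k)) (n : ℕ) : ℕ :=
  Module.finrank k (↥(piece J n) ⧸ (piece I n).submoduleOf (piece J n))

/-- The ideal of a line in `ℙ³`: it is generated by two independent linear forms. -/
def IsLineIdeal (L : Ideal (S k)) : Prop :=
  ∃ u v : S k, u ∈ homogeneousSubmodule (Fin 4) k 1 ∧ v ∈ homogeneousSubmodule (Fin 4) k 1 ∧
    LinearIndependent k ![u, v] ∧ L = Ideal.span {u, v}

/-- The closed subscheme `C` is a curve: locally Cohen-Macaulay and purely one-dimensional, that is,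
nonempty and without associated points (generic points of components, or embedded points) of
dimension other than one. In the homogeneous coordinate ring: the associated primes of `S / I_C` are
all of dimension two. -/
def IsCurve (C : (P3 k).IdealSheafData) : Prop :=
  homIdeal C ≠ ⊤ ∧
    ∀ P ∈ associatedPrimes (S k) (S k ⧸ homIdeal C), ringKrullDim (S k ⧸ P) = 2

/-- `C` has degree `d` and arithmetic genus `g`: its Hilbert polynomial `χ(𝒪_C(n))` is
`n d + 1 - g`. -/
def HasDegreeGenus (C : (P3 k).IdealSheafData) (d : ℕ) (g : ℤ) : Prop :=
  ∀ᶠ n : ℕ in atTop, (gradedDim ⊤ (homIdeal C) n : ℤ) = n * d + 1 - g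

/-- The homogeneous ideal of the (reduced) support of `C`. -/
def supportIdeal (C : (P3 k).IdealSheafData) : Ideal (S k) := (homIdeal C).radical

/-- `C` is a `d`-uple line of arithmetic genus `g`: a curve of degree `d` and genus `g` whose
support is a line. -/
structure IsMultipleLine (C : (P3 k).IdealSheafData) (d : ℕ) (g : ℤ) : Prop where
  isCurve : IsCurve C
  isLine : IsLineIdeal (supportIdeal C)
  degreeGenus : HasDegreeGenus C d g

/-- `C` is a `C_{d,ℓ}`: a `d`-uple line, with support `L`, of genus
`-(d-1) - binom d 3 - ℓ binom d 2`, with `H⁰(ℐ_C(ℓ+d-1)) = H⁰(ℐ_L^d(ℓ+d-1))`. -/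
structure IsC (d l : ℕ) (C : (P3 k).IdealSheafData) : Prop where
  multipleLine : IsMultipleLine C d (-((d : ℤ) - 1) - (d.choose 3 : ℤ) - (l : ℤ) * (d.choose 2 : ℤ))
  sections_eq : piece (homIdeal C) (l + d - 1) = piece (supportIdeal C ^ d) (l + d - 1)

/-- For a prime ideal `P` minimal over `I`: the ideal `{f | ∃ s ∉ P, s f ∈ I}`, that is, the
`P`-primary component of `I`. If `P` is the only minimal prime of `I`, the subscheme it defines is
obtained from that of `I` by removing the embedded points. -/
def removeEmbedded (P I : Ideal (S k)) : Ideal (S k) :=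
  Ideal.span {f | ∃ s : S k, s ∉ P ∧ s * f ∈ I}

/-- The homogeneous ideal of the `j`-th member `C_j` of the Cohen-Macaulay filtration of a multiple
line `C` with support `L`: `C_j` is obtained by removing the embedded points from `C ∩ L_j`, where
`L_j` is the subscheme with ideal `I_L^j`. -/
def filtrant (C : (P3 k).IdealSheafData) (j : ℕ) : Ideal (S k) :=
  removeEmbedded (supportIdeal C) (homIdeal C ⊔ supportIdeal C ^ j)

/-- The coherent sheaf associated with `J / I`, assumed to be an `𝒪_L`-module on a line `L ≅ ℙ¹`,
has rank `r` and degree `e`: its Hilbert polynomial is `r (n + 1) + e`. -/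
def HasRankDegree (J I : Ideal (S k)) (r : ℕ) (e : ℤ) : Prop :=
  ∀ᶠ n : ℕ in atTop, (gradedDim J I n : ℤ) = r * (n + 1) + e

/-- The quasiprimitive `d`-uple line `C` has type `(a; b₂, …, b_{d-1})`: with
`𝓛_j = ℐ_{C_j} / ℐ_{C_{j+1}}`, the line bundle `𝓛₁` has degree `a`, and `b_j` is the degree of the
effective divisor `D_j` of the generically surjective multiplication map `𝓛₁^j → 𝓛_j`, that is, of
its cokernel `ℐ_{C_j} / (ℐ_{C_1}^j + ℐ_{C_{j+1}})`, a torsion sheaf on the support. -/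
structure HasType (C : (P3 k).IdealSheafData) (d : ℕ) (a : ℤ) (b : ℕ → ℤ) : Prop where
  degree_one : HasRankDegree (filtrant C 1) (filtrant C 2) 1 a
  degree_divisor : ∀ j ∈ Finset.Icc 2 (d - 1),
    HasRankDegree (filtrant C j) (filtrant C 1 ^ j ⊔ filtrant C (j + 1)) 0 (b j)

/-- The closed points of the subscheme of `ℙ³` defined by a homogeneous ideal. -/
def points (I : Ideal (S k)) : Set (ℙ k (Fin 4 → k)) :=
  {p | ∀ f ∈ I, eval p.rep f = 0}

/-- The Zariski tangent space, at a point of `k⁴`, of the affine cone defined by `I`. -/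
def coneTangentSpace (I : Ideal (S k)) (p : Fin 4 → k) : Submodule k (Fin 4 → k) where
  carrier := {v | ∀ f ∈ I, ∑ i, eval p (pderiv i f) * v i = 0}
  add_mem' {v w} hv hw f hf := by
    have h1 := hv f hf
    have h2 := hw f hf
    simp only [Pi.add_apply, mul_add, Finset.sum_add_distrib, h1, h2, add_zero]
  zero_mem' f _ := by simp
  smul_mem' c v hv f hf := by
    have h := hv f hf
    simp only [Pi.smul_apply, smul_eq_mul, mul_left_comm _ c, ← Finset.mul_sum, h, mul_zero]

/-- The embedding dimension of `C` at a closed point `p` of `C`, i.e. the dimension of its Zariski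
tangent space there; this is one less than that of the affine cone over `C`. -/
def embDim (C : (P3 k).IdealSheafData) (p : ℙ k (Fin 4 → k)) : ℕ :=
  Module.finrank k (coneTangentSpace (homIdeal C) p.rep) - 1

/-- A multiple line is quasiprimitive if it has generically embedding dimension two. -/
def IsQuasiprimitive (C : (P3 k).IdealSheafData) : Prop :=
  {p ∈ points (supportIdeal C) | embDim C p ≠ 2}.Finite

/-- A multiple line is primitive if it has embedding dimension two everywhere. -/
def IsPrimitive (C : (P3 k).IdealSheafData) : Prop :=
  ∀ p ∈ points (supportIdeal C), embDim C p = 2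

end SpaceCurve

end

/-!
Let `I` be the homogeneous ideal of `C`, `L = (u, v)` that of the supporting line, `J_j` that of
`C_j`, and let `𝓛_j = J_j / J_{j+1}`. The absence of embedded points makes `I` primary to `L`, and
each `𝓛_j` a torsion-free graded module over `A = S / L`, a polynomial ring in two variables.

*All `𝓛_j` with `j < d` have rank one.* If `L ^ j ≤ I` for some `j < d`, then `u ^ (d - 1)` times the
`l`-th power of a linear form not in `L` is a form of degree `l + d - 1` in `I` but not in `L ^ d`,
against the hypothesis. Hence the filtration has at least `d` non-zero quotients. The Hilbert
function of a non-zero `𝓛_j` grows by at least one in each step: an injective pencil of maps `V → W`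
over an algebraically closed field forces `dim V < dim W` (`finrank_lt_of_injective_pencil`,
`gradedDim_lt_succ`). Since the Hilbert function of `S / I` grows by `d`, there are exactly `d`
non-zero quotients, and the Hilbert function of `𝓛_j` is eventually `n + 1 + δ_j`
(`rank_one_of_not_pow_le`). The genus gives `∑ δ_j = binom d 3 + l binom d 2`.

*The type.* As `A` is a unique factorization domain, `J_2 = L ^ 2 + (f u - g v)` with coprime binary
forms `f, g` of some degree `e` (`exists_conormalRelation`). Comparing the images of `L ^ j` in `𝓛_j`
for successive `j`, by multiplication by `u`, shows that the image has degree `j (e - 1)`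
(`hilb_pow_sup_fil`). Hence `a = e - 1` and `b_j = δ_j - j a`, which yields the formula for `∑ b_j`
and, as `b_j ≥ 0`, the upper bound for `a`. If `e ≤ l`, then a multiple of `u ^ (d - 2) (f u - g v)`
is a form of degree `l + d - 1` in `I` but not in `L ^ d`; this gives the lower bound
(`RankOneFiltration.le_of_sections_eq`).

*Embedding dimensions.* At a point `p` of the line, the tangent space is a plane if and only if
some `t (f u - g v)` with `t(p) ≠ 0` belongs to `I + L ^ 2` and `f, g` do not both vanish at `p`.
There is such a form `t` not in `L`, so this fails at most at the finitely many zeros of `t g` on the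
line (where `g ≠ 0`, if necessary after exchanging `u` and `v`), and `C` is quasiprimitive. If `C` is
primitive, then `J_j` and `I + L ^ j` agree locally on the line (`exists_pow_mul_mem`), and by the
Nullstellensatz the cokernel of `𝓛_1 ^ j → 𝓛_j` has finite length, so that `b_j = 0`.
-/

noncomputable section

namespace SpaceCurve

variable {k : Type u} [Field k]

/-! ### Hilbert functions of homogeneous ideals -/

theorem coe_decompose (f : S k) (n : ℕ) :
    (DirectSum.decompose (homogeneousSubmodule (Fin 4) k) f n : S k) = homogeneousComponent n f :=
  decomposition.decompose'_apply f n

theorem homogeneousComponent_mul_left {w : S k} {e : ℕ} (hw : w.IsHomogeneous e) (f : S k) (n : ℕ) :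
    homogeneousComponent (n + e) (w * f) = w * homogeneousComponent n f := by
  rw [← coe_decompose, ← coe_decompose, add_comm]
  exact DirectSum.coe_decompose_mul_add_of_left_mem _ ((mem_homogeneousSubmodule _ _).2 hw)

theorem homogeneousComponent_of_isHomogeneous {f : S k} {n : ℕ} (hf : f.IsHomogeneous n) :
    homogeneousComponent n f = f :=
  homogeneousComponent_eq_self ((mem_homogeneousSubmodule _ _).2 hf)

instance piece_finite (I : Ideal (S k)) (n : ℕ) : Module.Finite k (piece I n) := by
  have h : Module.Finite k (homogeneousSubmodule (Fin 4) k n) :=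
    Module.Finite.iff_fg.2 (homogeneousSubmodule_fg (Fin 4) k n)
  exact Submodule.finiteDimensional_of_le (inf_le_right : piece I n ≤ homogeneousSubmodule (Fin 4) k n)

/-- The Hilbert function of an ideal: the dimension of its degree `n` part, as an integer. -/
def hilb (I : Ideal (S k)) (n : ℕ) : ℤ := Module.finrank k (piece I n)

theorem piece_mono {I J : Ideal (S k)} (h : I ≤ J) (n : ℕ) : piece I n ≤ piece J n :=
  fun _ hf => ⟨h hf.1, hf.2⟩

theorem gradedDim_eq_sub {I J : Ideal (S k)} (h : I ≤ J) (n : ℕ) :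
    (gradedDim J I n : ℤ) = hilb J n - hilb I n := by
  have h1 := Submodule.finrank_quotient_add_finrank ((piece I n).submoduleOf (piece J n))
  rw [(Submodule.submoduleOfEquivOfLe (piece_mono h n)).finrank_eq] at h1
  unfold gradedDim hilb
  omega

theorem component_mem {I : Ideal (S k)}
    (hI : I.IsHomogeneous (homogeneousSubmodule (Fin 4) k)) {f : S k} (hf : f ∈ I) (n : ℕ) :
    homogeneousComponent n f ∈ I := homogeneousComponent_mem_of_mem hI hf n

theorem isHomogeneous_of_component_mem {I : Ideal (S k)}
    (h : ∀ f ∈ I, ∀ n, homogeneousComponent n f ∈ I) :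
    I.IsHomogeneous (homogeneousSubmodule (Fin 4) k) := by
  intro n f hf
  have := h f hf n
  rwa [← coe_decompose] at this

theorem isHomogeneous_pow {I : Ideal (S k)}
    (hI : I.IsHomogeneous (homogeneousSubmodule (Fin 4) k)) (n : ℕ) :
    (I ^ n).IsHomogeneous (homogeneousSubmodule (Fin 4) k) := by
  induction n with
  | zero => rw [pow_zero, Ideal.one_eq_top]; exact Ideal.IsHomogeneous.top _
  | succ n ih => rw [pow_succ]; exact Ideal.IsHomogeneous.mul ih hI

theorem isHomogeneous_span_singleton {f : S k} {n : ℕ} (hf : f.IsHomogeneous n) :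
    (Ideal.span {f}).IsHomogeneous (homogeneousSubmodule (Fin 4) k) :=
  Ideal.homogeneous_span _ _ (by rintro _ rfl; exact ⟨n, hf⟩)

/-- Multiplication by a form `w` of degree `e` identifies `J / K`, where
`K = {f ∈ J | w f ∈ Q}`, with `(w J + Q) / Q` up to a shift of degrees by `e`. -/
theorem hilb_mul_sup {w : S k} {e : ℕ} (hw : w.IsHomogeneous e) (hw0 : w ≠ 0)
    {J Q K : Ideal (S k)} (hJ : J.IsHomogeneous (homogeneousSubmodule (Fin 4) k))
    (hQ : Q.IsHomogeneous (homogeneousSubmodule (Fin 4) k))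
    (hK : ∀ f, f ∈ K ↔ f ∈ J ∧ w * f ∈ Q) (n : ℕ) :
    hilb (Ideal.span {w} * J ⊔ Q) (n + e) - hilb Q (n + e) = hilb J n - hilb K n := by
  have hinj : Function.Injective (LinearMap.mulLeft k w) := fun a b hab =>
    mul_left_cancel₀ hw0 hab
  have hsup : piece (Ideal.span {w} * J ⊔ Q) (n + e) =
      (piece J n).map (LinearMap.mulLeft k w) ⊔ piece Q (n + e) := by
    apply le_antisymm
    · intro x hx
      obtain ⟨a, ha, q, hq, rfl⟩ := Submodule.mem_sup.1 hx.1
      obtain ⟨f, hf, rfl⟩ := Ideal.mem_span_singleton_mul.1 ha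
      rw [← homogeneousComponent_of_isHomogeneous hx.2, map_add,
        homogeneousComponent_mul_left hw]
      exact Submodule.add_mem_sup
        ⟨_, ⟨component_mem hJ hf n, homogeneousComponent_mem n f⟩, rfl⟩
        ⟨component_mem hQ hq _, homogeneousComponent_mem _ _⟩
    · apply sup_le
      · rintro _ ⟨f, hf, rfl⟩
        refine ⟨Ideal.mem_sup_left (Ideal.mem_span_singleton_mul.2 ⟨f, hf.1, rfl⟩), ?_⟩
        have := IsHomogeneous.mul hw hf.2
        rwa [add_comm] at this
      · exact piece_mono le_sup_right _
  have hinf : (piece J n).map (LinearMap.mulLeft k w) ⊓ piece Q (n + e) =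
      (piece K n).map (LinearMap.mulLeft k w) := by
    ext x
    constructor
    · rintro ⟨⟨f, hf, rfl⟩, hx⟩
      exact ⟨f, ⟨(hK f).2 ⟨hf.1, hx.1⟩, hf.2⟩, rfl⟩
    · rintro ⟨f, hf, rfl⟩
      have h := (hK f).1 hf.1
      refine ⟨⟨f, ⟨h.1, hf.2⟩, rfl⟩, h.2, ?_⟩
      have := IsHomogeneous.mul hw hf.2
      rwa [add_comm] at this
  have hdim := Submodule.finrank_sup_add_finrank_inf_eq
    ((piece J n).map (LinearMap.mulLeft k w)) (piece Q (n + e))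
  rw [← hsup, hinf, ← (Submodule.equivMapOfInjective _ hinj (piece J n)).finrank_eq,
    ← (Submodule.equivMapOfInjective _ hinj (piece K n)).finrank_eq] at hdim
  unfold hilb
  omega

/-- A pencil of injective maps `V → W` over an algebraically closed field forces
`dim V < dim W`: otherwise `z⁻¹ w` would be an endomorphism of `V` without eigenvalues. -/
theorem finrank_lt_of_injective_pencil [IsAlgClosed k] {V W : Type*} [AddCommGroup V] [Module k V]
    [AddCommGroup W] [Module k W] [Module.Finite k V] [Module.Finite k W] [Nontrivial V]
    (z w : V →ₗ[k] W) (hz : Function.Injective z)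
    (hzw : ∀ c : k, Function.Injective (w - c • z)) :
    Module.finrank k V < Module.finrank k W := by
  by_contra hlt
  have heq : Module.finrank k V = Module.finrank k W :=
    le_antisymm (LinearMap.finrank_le_finrank_of_injective hz) (not_lt.1 hlt)
  let Z := LinearEquiv.ofInjectiveOfFinrankEq z hz heq
  obtain ⟨c, hc⟩ := Module.End.exists_eigenvalue (Z.symm.toLinearMap ∘ₗ w)
  obtain ⟨x, hx⟩ := hc.exists_hasEigenvector
  refine hx.2 (hzw c ?_)
  have h1 : Z.symm (w x) = c • x := hx.apply_eq_smul
  have h2 : w x = c • z x := by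
    have := congrArg Z h1
    rw [LinearEquiv.apply_symm_apply, map_smul] at this
    exact this
  simp [h2]

/-- If `J / I` is torsion free over a pencil of linear forms, then its Hilbert function increases
strictly once it is non-zero. -/
theorem gradedDim_lt_succ [IsAlgClosed k] {I J : Ideal (S k)} {z w : S k}
    (hz : z.IsHomogeneous 1) (hw : w.IsHomogeneous 1)
    (hzI : ∀ f, z * f ∈ I → f ∈ I) (hzw : ∀ (c : k) (f : S k), (w - C c * z) * f ∈ I → f ∈ I)
    {n : ℕ} (hn : ∃ f ∈ piece J n, f ∉ I) :
    gradedDim J I n < gradedDim J I (n + 1) := by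
  have key : ∀ t : S k, t.IsHomogeneous 1 → ∃ T : (↥(piece J n) ⧸ (piece I n).submoduleOf (piece J n))
      →ₗ[k] (↥(piece J (n + 1)) ⧸ (piece I (n + 1)).submoduleOf (piece J (n + 1))),
      ∀ f (hf : f ∈ piece J n) (hf' : t * f ∈ piece J (n + 1)),
        T (Submodule.Quotient.mk ⟨f, hf⟩) = Submodule.Quotient.mk ⟨t * f, hf'⟩ := by
    intro t ht
    have hmul : ∀ (K : Ideal (S k)) (f : S k), f ∈ piece K n → t * f ∈ piece K (n + 1) := by
      intro K f hf
      refine ⟨K.mul_mem_left t hf.1, ?_⟩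
      have := IsHomogeneous.mul ht hf.2
      rwa [add_comm] at this
    refine ⟨Submodule.mapQ _ _ ((LinearMap.mulLeft k t).restrict (hmul J)) ?_, ?_⟩
    · intro x hx
      exact hmul I _ hx
    · intro f hf hf'
      rfl
  have hmem : ∀ t : S k, t.IsHomogeneous 1 → ∀ f ∈ piece J n, t * f ∈ piece J (n + 1) := by
    intro t ht f hf
    refine ⟨J.mul_mem_left t hf.1, ?_⟩
    have := IsHomogeneous.mul ht hf.2
    rwa [add_comm] at this
  obtain ⟨Z, hZ⟩ := key z hz
  obtain ⟨W, hW⟩ := key w hw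
  obtain ⟨f₀, hf₀, hf₀I⟩ := hn
  have : Nontrivial (↥(piece J n) ⧸ (piece I n).submoduleOf (piece J n)) := by
    refine ⟨⟨Submodule.Quotient.mk ⟨f₀, hf₀⟩, 0, fun h => hf₀I ?_⟩⟩
    exact ((Submodule.Quotient.mk_eq_zero _).1 h).1
  refine finrank_lt_of_injective_pencil Z W ?_ fun c => ?_
  · rw [injective_iff_map_eq_zero]
    intro x hx
    obtain ⟨⟨f, hf⟩, rfl⟩ := Submodule.Quotient.mk_surjective _ x
    rw [hZ f hf (hmem z hz f hf), Submodule.Quotient.mk_eq_zero] at hx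
    exact (Submodule.Quotient.mk_eq_zero _).2 ⟨hzI f hx.1, hf.2⟩
  · rw [injective_iff_map_eq_zero]
    intro x hx
    obtain ⟨⟨f, hf⟩, rfl⟩ := Submodule.Quotient.mk_surjective _ x
    rw [LinearMap.sub_apply, LinearMap.smul_apply, hZ f hf (hmem z hz f hf),
      hW f hf (hmem w hw f hf), ← Submodule.Quotient.mk_smul, ← Submodule.Quotient.mk_sub,
      Submodule.Quotient.mk_eq_zero] at hx
    refine (Submodule.Quotient.mk_eq_zero _).2 ⟨hzw c f ?_, hf.2⟩
    have h1 : w * f - c • (z * f) ∈ I := hx.1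
    rw [smul_eq_C_mul] at h1
    convert h1 using 1
    ring

/-! ### Linear coordinates adapted to a line -/

/-- Linear coordinates `ℓ₀, …, ℓ₃` on `ℙ³`, together with the inverse linear change of coordinates
`τ`. The line considered in these coordinates is `ℓ₂ = ℓ₃ = 0`, with coordinates `ℓ₀, ℓ₁`. -/
structure Coords (ℓ τ : Fin 4 → S k) : Prop where
  isHomogeneous : ∀ i, (ℓ i).IsHomogeneous 1
  inv_isHomogeneous : ∀ i, (τ i).IsHomogeneous 1
  aeval_inv : ∀ i, aeval ℓ (τ i) = X i
  inv_aeval : ∀ i, aeval τ (ℓ i) = X i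

theorem exists_coords {u v : S k} (hu : u.IsHomogeneous 1) (hv : v.IsHomogeneous 1)
    (huv : LinearIndependent k ![u, v]) :
    ∃ ℓ τ : Fin 4 → S k, Coords ℓ τ ∧ ℓ 2 = u ∧ ℓ 3 = v := by
  classical
  let φ : (Fin 4 → k) →ₗ[k] S k := Fintype.linearCombination k (X : Fin 4 → S k)
  have hφ : ∀ c, φ c = ∑ i, c i • X i := fun c => Fintype.linearCombination_apply k _ c
  have hrange : ∀ f : S k, f.IsHomogeneous 1 → ∃ c, φ c = f := by
    intro f hf
    have h1 : f ∈ homogeneousSubmodule (Fin 4) k 1 := hf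
    rw [homogeneousSubmodule_one_eq_span_X, Submodule.mem_span_range_iff_exists_fun] at h1
    obtain ⟨c, hc⟩ := h1
    exact ⟨c, by rw [hφ, hc]⟩
  have hhom : ∀ c, (φ c).IsHomogeneous 1 := by
    intro c
    rw [hφ]
    refine IsHomogeneous.sum _ _ _ fun i _ => ?_
    rw [smul_eq_C_mul]
    exact isHomogeneous_C_mul_X _ _
  obtain ⟨cu, rfl⟩ := hrange u hu
  obtain ⟨cv, rfl⟩ := hrange v hv
  have h2 : LinearIndependent k ![cu, cv] := by
    apply LinearIndependent.of_comp φ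
    convert huv using 1
    ext i : 1
    fin_cases i <;> rfl
  obtain ⟨x, hx⟩ := exists_linearIndependent_cons_of_lt_finrank h2 (by simp)
  obtain ⟨y, hy⟩ := exists_linearIndependent_cons_of_lt_finrank hx (by simp)
  let N : Matrix (Fin 4) (Fin 4) k := Fin.cons y (Fin.cons x ![cu, cv])
  have hN : IsUnit N := Matrix.linearIndependent_rows_iff_isUnit.1 hy
  have hcomp : ∀ (P Q : Matrix (Fin 4) (Fin 4) k) (i : Fin 4),
      aeval (fun j => φ (Q j)) (φ (P i)) = φ ((P * Q) i) := by
    intro P Q i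
    simp only [hφ, map_sum, map_smul, aeval_X, Matrix.mul_apply, Finset.sum_smul,
      Finset.smul_sum, smul_smul]
    exact Finset.sum_comm
  have hone : ∀ i, φ ((1 : Matrix (Fin 4) (Fin 4) k) i) = X i := by
    intro i
    simp [hφ, Matrix.one_apply]
  have hdet : IsUnit N.det := (Matrix.isUnit_iff_isUnit_det N).1 hN
  refine ⟨fun i => φ (N i), fun i => φ (N⁻¹ i), ⟨fun i => hhom _, fun i => hhom _, ?_, ?_⟩, rfl, rfl⟩
  · intro i
    rw [hcomp, Matrix.nonsing_inv_mul _ hdet, hone]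
  · intro i
    rw [hcomp, Matrix.mul_nonsing_inv _ hdet, hone]

/-- The homomorphism out of `S` that sends the coordinate `ℓᵢ` to `t i`. -/
def coordsLift (τ : Fin 4 → S k) {B : Type*} [CommRing B] [Algebra k B] (t : Fin 4 → B) :
    S k →ₐ[k] B := aeval fun i => aeval t (τ i)

namespace Coords

variable {ℓ τ : Fin 4 → S k} (h : Coords ℓ τ)
include h

theorem lift_apply {B : Type*} [CommRing B] [Algebra k B] (t : Fin 4 → B) (i : Fin 4) :
    coordsLift τ t (ℓ i) = t i := by
  have h1 : coordsLift τ t = (aeval t).comp (aeval τ) := by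
    apply MvPolynomial.algHom_ext
    intro j
    simp [coordsLift]
  rw [h1, AlgHom.comp_apply, h.inv_aeval, aeval_X]

theorem hom_ext {B : Type*} [CommRing B] [Algebra k B] {φ ψ : S k →ₐ[k] B}
    (hφ : ∀ i, φ (ℓ i) = ψ (ℓ i)) : φ = ψ := by
  apply MvPolynomial.algHom_ext
  intro i
  have h1 : φ.comp (aeval ℓ) = ψ.comp (aeval ℓ) := by
    apply MvPolynomial.algHom_ext
    intro j
    simpa using hφ j
  have h2 := DFunLike.congr_fun h1 (τ i)
  rw [AlgHom.comp_apply, AlgHom.comp_apply, h.aeval_inv] at h2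
  exact h2

end Coords

/-- Restriction to the line `ℓ₂ = ℓ₃ = 0`, with values in its homogeneous coordinate ring. -/
def lineRestrict (τ : Fin 4 → S k) : S k →ₐ[k] MvPolynomial (Fin 2) k :=
  coordsLift τ ![X 0, X 1, 0, 0]

/-- The section of the restriction to the line provided by the coordinates. -/
def lineExtend (ℓ : Fin 4 → S k) : MvPolynomial (Fin 2) k →ₐ[k] S k := aeval ![ℓ 0, ℓ 1]

namespace Coords

variable {ℓ τ : Fin 4 → S k} (h : Coords ℓ τ)
include h

theorem restrict_zero : lineRestrict τ (ℓ 0) = X 0 := h.lift_apply _ 0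
theorem restrict_one : lineRestrict τ (ℓ 1) = X 1 := h.lift_apply _ 1
theorem restrict_two : lineRestrict τ (ℓ 2) = 0 := h.lift_apply _ 2
theorem restrict_three : lineRestrict τ (ℓ 3) = 0 := h.lift_apply _ 3

theorem restrict_extend (f : MvPolynomial (Fin 2) k) : lineRestrict τ (lineExtend ℓ f) = f := by
  have h1 : (lineRestrict τ).comp (lineExtend ℓ) = AlgHom.id k _ := by
    apply MvPolynomial.algHom_ext
    intro i
    fin_cases i
    · simpa [lineExtend] using h.restrict_zero
    · simpa [lineExtend] using h.restrict_one
  exact DFunLike.congr_fun h1 f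

theorem sub_extend_restrict_mem (f : S k) :
    f - lineExtend ℓ (lineRestrict τ f) ∈ Ideal.span {ℓ 2, ℓ 3} := by
  have h1 : ((Ideal.Quotient.mkₐ k (Ideal.span {ℓ 2, ℓ 3})).comp (lineExtend ℓ)).comp
      (lineRestrict τ) = Ideal.Quotient.mkₐ k (Ideal.span {ℓ 2, ℓ 3}) := by
    apply h.hom_ext
    intro i
    have h2 : (Ideal.Quotient.mk (Ideal.span {ℓ 2, ℓ 3})) (ℓ 2) = 0 :=
      Ideal.Quotient.eq_zero_iff_mem.2 (Ideal.subset_span (by simp))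
    have h3 : (Ideal.Quotient.mk (Ideal.span {ℓ 2, ℓ 3})) (ℓ 3) = 0 :=
      Ideal.Quotient.eq_zero_iff_mem.2 (Ideal.subset_span (by simp))
    fin_cases i
    · simp [h.restrict_zero, lineExtend]
    · simp [h.restrict_one, lineExtend]
    · simp [h.restrict_two, h2]
    · simp [h.restrict_three, h3]
  have h2 := DFunLike.congr_fun h1 f
  rw [← Ideal.Quotient.eq_zero_iff_mem, map_sub, sub_eq_zero]
  exact h2.symm

theorem mem_line_iff (f : S k) : f ∈ Ideal.span {ℓ 2, ℓ 3} ↔ lineRestrict τ f = 0 := by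
  constructor
  · intro hf
    have h1 : Ideal.span {ℓ 2, ℓ 3} ≤ RingHom.ker (lineRestrict τ) := by
      rw [Ideal.span_le]
      rintro x (rfl | rfl)
      · exact h.restrict_two
      · exact h.restrict_three
    exact h1 hf
  · intro hf
    have h1 := h.sub_extend_restrict_mem f
    rwa [hf, map_zero, sub_zero] at h1

theorem line_isPrime : (Ideal.span {ℓ 2, ℓ 3}).IsPrime := by
  have h1 : Ideal.span {ℓ 2, ℓ 3} = RingHom.ker (lineRestrict τ) := by
    ext f
    rw [h.mem_line_iff, RingHom.mem_ker]
  rw [h1]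
  exact RingHom.ker_isPrime _

theorem restrict_isHomogeneous {f : S k} {n : ℕ} (hf : f.IsHomogeneous n) :
    (lineRestrict τ f).IsHomogeneous n := by
  have h1 : ∀ i : Fin 4, ((![X 0, X 1, 0, 0] : Fin 4 → MvPolynomial (Fin 2) k) i).IsHomogeneous 1 := by
    intro i
    fin_cases i
    · exact isHomogeneous_X _ _
    · exact isHomogeneous_X _ _
    · exact isHomogeneous_zero _ _ _
    · exact isHomogeneous_zero _ _ _
  have h2 := hf.aeval (fun i => aeval (![X 0, X 1, 0, 0] : Fin 4 → MvPolynomial (Fin 2) k) (τ i))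
    (n := 1) (fun i => by simpa using (h.inv_isHomogeneous i).aeval _ h1)
  rwa [one_mul] at h2

theorem extend_isHomogeneous {f : MvPolynomial (Fin 2) k} {n : ℕ} (hf : f.IsHomogeneous n) :
    (lineExtend ℓ f).IsHomogeneous n := by
  have h2 := hf.aeval ![ℓ 0, ℓ 1] (n := 1) (fun i => by
    fin_cases i
    · exact h.isHomogeneous 0
    · exact h.isHomogeneous 1)
  rwa [one_mul] at h2

theorem one_notMem_line : ℓ 1 ∉ Ideal.span {ℓ 2, ℓ 3} := by
  rw [h.mem_line_iff, h.restrict_one]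
  exact X_ne_zero _

theorem pencil_notMem_line (c : k) : ℓ 0 - C c * ℓ 1 ∉ Ideal.span {ℓ 2, ℓ 3} := by
  rw [h.mem_line_iff, map_sub, map_mul, h.restrict_zero, h.restrict_one]
  intro h0
  have h1 : (lineRestrict τ) (C c) = C c := (lineRestrict τ).commutes c
  rw [h1] at h0
  have h2 := congrArg (eval ![1, 0]) h0
  simp at h2

/-- The scaling `ℓ₂ ↦ T ℓ₂`, `ℓ₃ ↦ T ℓ₃` detects the order of vanishing along the line. -/
theorem mem_line_pow_iff (f : S k) (j : ℕ) : f ∈ Ideal.span {ℓ 2, ℓ 3} ^ j ↔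
    Polynomial.X ^ j ∣ coordsLift τ ![Polynomial.C (ℓ 0), Polynomial.C (ℓ 1),
      Polynomial.X * Polynomial.C (ℓ 2), Polynomial.X * Polynomial.C (ℓ 3)] f := by
  set t : Fin 4 → Polynomial (S k) := ![Polynomial.C (ℓ 0), Polynomial.C (ℓ 1),
      Polynomial.X * Polynomial.C (ℓ 2), Polynomial.X * Polynomial.C (ℓ 3)] with ht
  constructor
  · intro hf
    have h1 : (Ideal.span {ℓ 2, ℓ 3}).map (coordsLift τ t).toRingHom ≤
        Ideal.span {Polynomial.X} := by
      rw [Ideal.map_le_iff_le_comap, Ideal.span_le]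
      rintro x (rfl | rfl)
      · refine Ideal.mem_span_singleton.2 ⟨_, h.lift_apply t 2⟩
      · refine Ideal.mem_span_singleton.2 ⟨_, h.lift_apply t 3⟩
    have h2 : coordsLift τ t f ∈ ((Ideal.span {ℓ 2, ℓ 3}) ^ j).map (coordsLift τ t).toRingHom :=
      Ideal.mem_map_of_mem (coordsLift τ t).toRingHom hf
    rw [Ideal.map_pow] at h2
    have h3 := Ideal.pow_right_mono h1 j h2
    rwa [Ideal.span_singleton_pow, Ideal.mem_span_singleton] at h3
  · intro hf
    let R : Subalgebra k (Polynomial (S k)) :=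
      (reesAlgebra (Ideal.span {ℓ 2, ℓ 3})).restrictScalars k
    have hC : ∀ a : S k, Polynomial.C a ∈ R := fun a =>
      (reesAlgebra (Ideal.span {ℓ 2, ℓ 3})).algebraMap_mem a
    have hX : ∀ a ∈ Ideal.span {ℓ 2, ℓ 3}, Polynomial.X * Polynomial.C a ∈ R := by
      intro a ha
      have := reesAlgebra.monomial_mem (I := Ideal.span {ℓ 2, ℓ 3}) (i := 1) (r := a)
      rw [pow_one] at this
      rw [Polynomial.X_mul_C, ← pow_one Polynomial.X, Polynomial.C_mul_X_pow_eq_monomial]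
      exact this.2 ha
    have htR : ∀ i, t i ∈ R := by
      intro i
      fin_cases i
      · exact hC _
      · exact hC _
      · exact hX _ (Ideal.subset_span (by simp))
      · exact hX _ (Ideal.subset_span (by simp))
    have haeval : ∀ (s : Fin 4 → Polynomial (S k)), (∀ i, s i ∈ R) →
        ∀ p : S k, aeval s p ∈ R := by
      intro s hs p
      induction p using MvPolynomial.induction_on with
      | C a => rw [aeval_C]; exact R.algebraMap_mem a
      | add p q hp hq => rw [map_add]; exact R.add_mem hp hq
      | mul_X p i hp => rw [map_mul, aeval_X]; exact R.mul_mem hp (hs i)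
    have hfR : coordsLift τ t f ∈ R := haeval _ (fun i => haeval t htR _) f
    have hcoeff := (mem_reesAlgebra_iff _ _).1 hfR
    have hev : ((Polynomial.aeval (1 : S k)).restrictScalars k).comp (coordsLift τ t) =
        AlgHom.id k (S k) := by
      apply h.hom_ext
      intro i
      rw [AlgHom.comp_apply, h.lift_apply]
      fin_cases i <;> simp [t]
    have hf1 : f = (coordsLift τ t f).eval 1 := by
      have := DFunLike.congr_fun hev f
      simpa [Polynomial.aeval_def, Polynomial.eval₂_eq_eval_map] using this.symm
    rw [hf1, Polynomial.eval_eq_sum_range]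
    refine Ideal.sum_mem _ fun i _ => ?_
    rw [one_pow, mul_one]
    rcases lt_or_ge i j with hij | hij
    · rw [Polynomial.X_pow_dvd_iff.1 hf i hij]
      exact Ideal.zero_mem _
    · exact Ideal.pow_le_pow_right hij (hcoeff i)

/-- The associated graded ring of the ideal of a line is a domain. -/
theorem mem_or_mem_of_mul_mem {f g : S k} {i j : ℕ} (hf : f ∈ Ideal.span {ℓ 2, ℓ 3} ^ i)
    (hg : g ∈ Ideal.span {ℓ 2, ℓ 3} ^ j) (hfg : f * g ∈ Ideal.span {ℓ 2, ℓ 3} ^ (i + j + 1)) :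
    f ∈ Ideal.span {ℓ 2, ℓ 3} ^ (i + 1) ∨ g ∈ Ideal.span {ℓ 2, ℓ 3} ^ (j + 1) := by
  rw [h.mem_line_pow_iff] at hf hg hfg ⊢
  rw [h.mem_line_pow_iff]
  rw [map_mul] at hfg
  exact succ_dvd_or_succ_dvd_of_succ_sum_dvd_mul Polynomial.prime_X hf hg hfg

/-- As the conormal module of the line is free on `ℓ₂, ℓ₃`, the coefficient of `ℓ₂` in a relation
vanishes on the line. -/
theorem mem_of_relation_two {f g : S k}
    (hfg : f * ℓ 2 - g * ℓ 3 ∈ Ideal.span {ℓ 2, ℓ 3} ^ 2) : f ∈ Ideal.span {ℓ 2, ℓ 3} := by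
  set t : Fin 4 → Polynomial (MvPolynomial (Fin 2) k) :=
    ![Polynomial.C (X 0), Polynomial.C (X 1), Polynomial.X, 0] with ht
  have h1 : (Ideal.span {ℓ 2, ℓ 3}).map (coordsLift τ t).toRingHom ≤
      Ideal.span {Polynomial.X} := by
    rw [Ideal.map_le_iff_le_comap, Ideal.span_le]
    rintro x (rfl | rfl)
    · exact Ideal.mem_span_singleton.2 (by
        have := h.lift_apply t 2
        change _ ∣ coordsLift τ t (ℓ 2)
        rw [this]; exact dvd_refl _)
    · exact Ideal.mem_span_singleton.2 (by
        have := h.lift_apply t 3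
        change _ ∣ coordsLift τ t (ℓ 3)
        rw [this]; exact dvd_zero _)
  have h2 := Ideal.mem_map_of_mem (coordsLift τ t).toRingHom hfg
  rw [Ideal.map_pow] at h2
  have h3 := Ideal.pow_right_mono h1 2 h2
  rw [Ideal.span_singleton_pow, Ideal.mem_span_singleton] at h3
  change Polynomial.X ^ 2 ∣ coordsLift τ t (f * ℓ 2 - g * ℓ 3) at h3
  have e2 : coordsLift τ t (ℓ 2) = Polynomial.X := h.lift_apply t 2
  have e3 : coordsLift τ t (ℓ 3) = 0 := h.lift_apply t 3
  rw [map_sub, map_mul, map_mul, e2, e3, mul_zero, sub_zero, pow_two] at h3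
  have h4 := (mul_dvd_mul_iff_right Polynomial.X_ne_zero).1 h3
  have hev : ((Polynomial.aeval (0 : MvPolynomial (Fin 2) k)).restrictScalars k).comp
      (coordsLift τ t) = lineRestrict τ := by
    apply h.hom_ext
    intro i
    rw [AlgHom.comp_apply, h.lift_apply, lineRestrict, h.lift_apply]
    fin_cases i <;> simp [t]
  rw [h.mem_line_iff, ← hev]
  obtain ⟨q, hq⟩ := h4
  simp [hq]

theorem swap : Coords ![ℓ 0, ℓ 1, ℓ 3, ℓ 2] (fun i => rename (Equiv.swap (2 : Fin 4) 3) (τ i)) := by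
  have h1 : (![ℓ 0, ℓ 1, ℓ 3, ℓ 2] : Fin 4 → S k) = fun i => ℓ (Equiv.swap (2 : Fin 4) 3 i) := by
    ext i : 1
    fin_cases i <;> rfl
  rw [h1]
  refine ⟨fun i => h.isHomogeneous _, fun i => (h.inv_isHomogeneous i).rename_isHomogeneous,
    fun i => ?_, fun i => ?_⟩
  · rw [aeval_rename]
    have : (fun i => ℓ (Equiv.swap (2 : Fin 4) 3 i)) ∘ (Equiv.swap (2 : Fin 4) 3) = ℓ := by
      ext i : 1
      simp
    rw [this, h.aeval_inv]
  · have : aeval (fun i => rename (Equiv.swap (2 : Fin 4) 3) (τ i)) =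
        (rename (Equiv.swap (2 : Fin 4) 3)).comp (aeval τ) := by
      apply MvPolynomial.algHom_ext
      intro j
      simp
    rw [this, AlgHom.comp_apply, h.inv_aeval, rename_X, Equiv.swap_apply_self]

theorem mem_of_relation_three {f g : S k}
    (hfg : f * ℓ 2 - g * ℓ 3 ∈ Ideal.span {ℓ 2, ℓ 3} ^ 2) : g ∈ Ideal.span {ℓ 2, ℓ 3} := by
  rw [Set.pair_comm] at hfg ⊢
  refine h.swap.mem_of_relation_two (f := g) (g := f) ?_
  have := neg_mem hfg
  rw [neg_sub] at this
  exact this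

theorem two_pow_notMem (n : ℕ) : ℓ 2 ^ n ∉ Ideal.span {ℓ 2, ℓ 3} ^ (n + 1) := by
  have h2 : ℓ 2 ∈ Ideal.span {ℓ 2, ℓ 3} := Ideal.subset_span (by simp)
  induction n with
  | zero =>
    rw [zero_add, pow_zero, pow_one, ← Ideal.ne_top_iff_one]
    exact h.line_isPrime.ne_top
  | succ n ih =>
    intro hn
    rw [pow_succ] at hn
    rcases h.mem_or_mem_of_mul_mem (Ideal.pow_mem_pow h2 n) (by rwa [pow_one] : ℓ 2 ∈ _ ^ 1) hn
      with h3 | h3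
    · exact ih h3
    · have h4 : (1 : S k) * ℓ 2 - 0 * ℓ 3 ∈ Ideal.span {ℓ 2, ℓ 3} ^ 2 := by simpa using h3
      exact h.line_isPrime.ne_top ((Ideal.eq_top_iff_one _).2 (h.mem_of_relation_two h4))

end Coords

theorem finrank_binary_forms (n : ℕ) :
    Module.finrank k (homogeneousSubmodule (Fin 2) k n) = n + 1 := by
  rw [homogeneousSubmodule_eq_finsupp_supported]
  have e : {d : Fin 2 →₀ ℕ | d.degree = n} ≃ Fin (n + 1) :=
    { toFun := fun d => ⟨d.1 0, by
        have h1 : d.1.degree = n := d.2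
        rw [Finsupp.degree_eq_sum, Fin.sum_univ_two] at h1
        omega⟩
      invFun := fun i => ⟨Finsupp.single 0 i.1 + Finsupp.single 1 (n - i.1), by
        have := i.2
        simp [Finsupp.degree_eq_sum]
        omega⟩
      left_inv := by
        rintro ⟨d, hd⟩
        have h1 : d.degree = n := hd
        rw [Finsupp.degree_eq_sum, Fin.sum_univ_two] at h1
        ext i
        fin_cases i
        · simp
        · simp
          omega
      right_inv := by
        intro i
        ext
        simp }
  have : Fintype {d : Fin 2 →₀ ℕ | d.degree = n} := Fintype.ofEquiv _ e.symm
  rw [(AddMonoidAlgebra.supportedEquivFinsupp (R := k) (S := k) _).finrank_eq,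
    Module.finrank_finsupp_self, Fintype.card_congr e, Fintype.card_fin]

/-- The Hilbert function of a line. -/
theorem Coords.hilb_line {ℓ τ : Fin 4 → S k} (h : Coords ℓ τ) (n : ℕ) :
    hilb (⊤ : Ideal (S k)) n - hilb (Ideal.span {ℓ 2, ℓ 3}) n = n + 1 := by
  let T : piece (⊤ : Ideal (S k)) n →ₗ[k] homogeneousSubmodule (Fin 2) k n :=
    (lineRestrict τ).toLinearMap.restrict fun f hf => h.restrict_isHomogeneous hf.2
  have hT : Function.Surjective T := by
    rintro ⟨f, hf⟩
    refine ⟨⟨lineExtend ℓ f, trivial, h.extend_isHomogeneous hf⟩, ?_⟩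
    exact Subtype.ext (h.restrict_extend f)
  have hker : LinearMap.ker T =
      (piece (Ideal.span {ℓ 2, ℓ 3}) n).submoduleOf (piece ⊤ n) := by
    ext ⟨f, hf⟩
    rw [LinearMap.mem_ker]
    constructor
    · intro h0
      exact ⟨(h.mem_line_iff f).2 (congrArg Subtype.val h0), hf.2⟩
    · intro h0
      exact Subtype.ext ((h.mem_line_iff f).1 h0.1)
  have h1 := LinearMap.finrank_range_add_finrank_ker T
  rw [LinearMap.range_eq_top.2 hT, finrank_top, finrank_binary_forms, hker,
    (Submodule.submoduleOfEquivOfLe (piece_mono le_top n)).finrank_eq] at h1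
  unfold hilb
  omega

/-! ### The Cohen-Macaulay filtration -/

/-- The homomorphism `f ↦ ∑ₙ fₙ Tⁿ`, where `fₙ` is the component of degree `n` of `f`. -/
def gradingHom : S k →ₐ[k] Polynomial (S k) :=
  aeval fun i => Polynomial.C (X i) * Polynomial.X

theorem coeff_gradingHom (f : S k) (n : ℕ) :
    (gradingHom f).coeff n = homogeneousComponent n f := by
  induction f using MvPolynomial.induction_on' with
  | monomial d c =>
    have h1 : gradingHom (monomial d c : S k) =
        Polynomial.C (monomial d c) * Polynomial.X ^ d.degree := by
      rw [gradingHom, aeval_monomial, Finsupp.prod]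
      simp only [mul_pow, Finset.prod_mul_distrib, Finset.prod_pow_eq_pow_sum]
      rw [← mul_assoc, monomial_eq, Finsupp.prod]
      simp only [map_mul, map_prod, map_pow]
      rfl
    rw [h1, Polynomial.coeff_C_mul_X_pow,
      homogeneousComponent_of_mem
        ((mem_homogeneousSubmodule _ _).2 (isHomogeneous_monomial c rfl))]
  | add p q hp hq => rw [map_add, Polynomial.coeff_add, hp, hq, map_add]

section removeEmbedded

variable {P Q : Ideal (S k)}

theorem mem_removeEmbedded (hP : P.IsPrime) {f : S k} :
    f ∈ removeEmbedded P Q ↔ ∃ s, s ∉ P ∧ s * f ∈ Q := by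
  constructor
  · intro hf
    refine Submodule.span_induction (p := fun f _ => ∃ s, s ∉ P ∧ s * f ∈ Q) ?_ ?_ ?_ ?_ hf
    · exact fun x hx => hx
    · exact ⟨1, fun h => hP.ne_top ((Ideal.eq_top_iff_one _).2 h), by simp⟩
    · rintro x y - - ⟨s, hs, hsx⟩ ⟨t, ht, hty⟩
      refine ⟨s * t, fun h => (hP.mem_or_mem h).elim hs ht, ?_⟩
      have h1 := Q.add_mem (Q.mul_mem_left t hsx) (Q.mul_mem_left s hty)
      convert h1 using 1
      ring
    · rintro a x - ⟨s, hs, hsx⟩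
      refine ⟨s, hs, ?_⟩
      have h1 := Q.mul_mem_left a hsx
      convert h1 using 1
      simp only [smul_eq_mul]
      ring
  · exact fun hf => Ideal.subset_span hf

theorem le_removeEmbedded (hP : P.IsPrime) : Q ≤ removeEmbedded P Q := fun f hf =>
  (mem_removeEmbedded hP).2
    ⟨1, fun h => hP.ne_top ((Ideal.eq_top_iff_one _).2 h), by rwa [one_mul]⟩

theorem removeEmbedded_saturated (hP : P.IsPrime) {s f : S k} (hs : s ∉ P)
    (hsf : s * f ∈ removeEmbedded P Q) : f ∈ removeEmbedded P Q := by
  obtain ⟨t, ht, h1⟩ := (mem_removeEmbedded hP).1 hsf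
  exact (mem_removeEmbedded hP).2
    ⟨t * s, fun h => (hP.mem_or_mem h).elim ht hs, by rwa [mul_assoc]⟩

/-- If the coefficients of `F G` lie in a `P`-saturated ideal `J` and some coefficient of `F` is not
in `P`, then the coefficients of `G` lie in `J`: by McCoy's theorem, `F` is a nonzerodivisor
modulo `J`. -/
theorem coeff_mem_of_saturated {R : Type*} [CommRing R] {J P : Ideal R}
    (hJ : ∀ s f, s ∉ P → s * f ∈ J → f ∈ J) {F G : Polynomial R} {m : ℕ} (hF : F.coeff m ∉ P)
    (hFG : ∀ n, (G * F).coeff n ∈ J) (n : ℕ) : G.coeff n ∈ J := by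
  have hprod : G.map (Ideal.Quotient.mk J) * F.map (Ideal.Quotient.mk J) = 0 := by
    rw [← Polynomial.map_mul]
    ext i
    rw [Polynomial.coeff_map, Polynomial.coeff_zero, Ideal.Quotient.eq_zero_iff_mem]
    exact hFG i
  have hreg : F.map (Ideal.Quotient.mk J) ∈ nonZeroDivisors (Polynomial (R ⧸ J)) := by
    by_contra hnot
    obtain ⟨a, ha, has⟩ := Polynomial.notMem_nonZeroDivisors_iff.1 hnot
    obtain ⟨b, rfl⟩ := Ideal.Quotient.mk_surjective a
    have h1 := congrArg (fun p => Polynomial.coeff p m) has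
    simp only [Polynomial.coeff_smul, Polynomial.coeff_map, Polynomial.coeff_zero, smul_eq_mul,
      ← map_mul, Ideal.Quotient.eq_zero_iff_mem] at h1
    rw [mul_comm] at h1
    exact ha (Ideal.Quotient.eq_zero_iff_mem.2 (hJ _ _ hF h1))
  have hzero := (mem_nonZeroDivisors_iff_right.1 hreg) _ hprod
  have h1 := congrArg (fun p => Polynomial.coeff p n) hzero
  simp only [Polynomial.coeff_map, Polynomial.coeff_zero] at h1
  exact Ideal.Quotient.eq_zero_iff_mem.1 h1

/-- The component of a homogeneous ideal at a homogeneous prime is homogeneous. -/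
theorem removeEmbedded_isHomogeneous (hP : P.IsPrime)
    (hPh : P.IsHomogeneous (homogeneousSubmodule (Fin 4) k))
    (hQ : Q.IsHomogeneous (homogeneousSubmodule (Fin 4) k)) :
    (removeEmbedded P Q).IsHomogeneous (homogeneousSubmodule (Fin 4) k) := by
  refine isHomogeneous_of_component_mem fun f hf n => ?_
  obtain ⟨s, hs, hsf⟩ := (mem_removeEmbedded hP).1 hf
  obtain ⟨m, hm⟩ : ∃ m, homogeneousComponent m s ∉ P := by
    by_contra! hall
    exact hs ((mem_iff_homogeneousComponent_mem hPh s).2 hall)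
  rw [← coeff_gradingHom] at hm ⊢
  refine coeff_mem_of_saturated (fun _ _ => removeEmbedded_saturated hP) hm (fun i => ?_) n
  rw [← map_mul, mul_comm f s, coeff_gradingHom]
  exact le_removeEmbedded hP (component_mem hQ hsf i)

end removeEmbedded

/-- The homogeneous ideal `I` is primary to the homogeneous prime ideal `L`. -/
structure IsPrimaryTo (I L : Ideal (S k)) : Prop where
  isPrime : L.IsPrime
  line_isHomogeneous : L.IsHomogeneous (homogeneousSubmodule (Fin 4) k)
  isHomogeneous : I.IsHomogeneous (homogeneousSubmodule (Fin 4) k)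
  le : I ≤ L
  saturated : ∀ s f : S k, s ∉ L → s * f ∈ I → f ∈ I
  exists_pow_le : ∃ N : ℕ, L ^ N ≤ I

/-- The Cohen-Macaulay filtration of a primary ideal `I` with radical `L`. -/
def cmFil (I L : Ideal (S k)) (j : ℕ) : Ideal (S k) := removeEmbedded L (I ⊔ L ^ j)

namespace IsPrimaryTo

variable {I L : Ideal (S k)} (h : IsPrimaryTo I L)
include h

theorem mem_fil {f : S k} {j : ℕ} : f ∈ cmFil I L j ↔ ∃ s, s ∉ L ∧ s * f ∈ I ⊔ L ^ j :=
  mem_removeEmbedded h.isPrime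

theorem sup_le_fil (j : ℕ) : I ⊔ L ^ j ≤ cmFil I L j := le_removeEmbedded h.isPrime

theorem le_fil (j : ℕ) : I ≤ cmFil I L j := le_sup_left.trans (h.sup_le_fil j)

theorem pow_le_fil (j : ℕ) : L ^ j ≤ cmFil I L j := le_sup_right.trans (h.sup_le_fil j)

theorem fil_saturated {j : ℕ} {s f : S k} (hs : s ∉ L) (hf : s * f ∈ cmFil I L j) :
    f ∈ cmFil I L j := removeEmbedded_saturated h.isPrime hs hf

theorem fil_isHomogeneous (j : ℕ) :
    (cmFil I L j).IsHomogeneous (homogeneousSubmodule (Fin 4) k) :=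
  removeEmbedded_isHomogeneous h.isPrime h.line_isHomogeneous
    (Ideal.IsHomogeneous.sup h.isHomogeneous (isHomogeneous_pow h.line_isHomogeneous j))

theorem fil_zero : cmFil I L 0 = ⊤ :=
  top_le_iff.1 (by simpa using h.pow_le_fil 0)

theorem fil_one : cmFil I L 1 = L := by
  refine le_antisymm (fun f hf => ?_) (by simpa using h.pow_le_fil 1)
  obtain ⟨s, hs, hsf⟩ := h.mem_fil.1 hf
  rw [pow_one, sup_eq_right.2 h.le] at hsf
  exact (h.isPrime.mem_or_mem hsf).resolve_left hs

theorem fil_succ_le (j : ℕ) : cmFil I L (j + 1) ≤ cmFil I L j := fun f hf => by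
  obtain ⟨s, hs, hsf⟩ := h.mem_fil.1 hf
  exact h.mem_fil.2 ⟨s, hs, sup_le_sup_left (Ideal.pow_le_pow_right j.le_succ) I hsf⟩

theorem mul_mem_fil {i j : ℕ} {f g : S k} (hf : f ∈ cmFil I L i) (hg : g ∈ L ^ j) :
    f * g ∈ cmFil I L (i + j) := by
  obtain ⟨s, hs, hsf⟩ := h.mem_fil.1 hf
  refine h.mem_fil.2 ⟨s, hs, ?_⟩
  obtain ⟨a, ha, b, hb, hab⟩ := Submodule.mem_sup.1 hsf
  rw [← mul_assoc, ← hab, add_mul, pow_add]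
  exact Submodule.add_mem_sup (I.mul_mem_right g ha) (Ideal.mul_mem_mul hb hg)

theorem fil_eq_of_pow_le {j : ℕ} (hj : L ^ j ≤ I) : cmFil I L j = I := by
  refine le_antisymm (fun f hf => ?_) (h.le_fil j)
  obtain ⟨s, hs, hsf⟩ := h.mem_fil.1 hf
  rw [sup_eq_left.2 hj] at hsf
  exact h.saturated s f hs hsf

/-- The filtration is strictly decreasing until it reaches `I`. -/
theorem pow_le_of_pow_le_fil_succ {j : ℕ} (hj : L ^ j ≤ cmFil I L (j + 1)) : L ^ j ≤ I := by
  have h1 : ∀ i, L ^ j ≤ cmFil I L (j + 1 + i) := by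
    intro i
    induction i with
    | zero => exact hj
    | succ i ih =>
      intro f hf
      obtain ⟨s, hs, hsf⟩ := h.mem_fil.1 (ih hf)
      refine h.fil_saturated hs ?_
      refine (sup_le (h.le_fil _) ?_) hsf
      have h2 : L ^ (j + 1 + i) = L ^ j * L ^ (i + 1) := by rw [← pow_add]; congr 1; ring
      rw [h2, Ideal.mul_le]
      intro a ha b hb
      exact h.mul_mem_fil (hj ha) hb
  obtain ⟨N, hN⟩ := h.exists_pow_le
  have h2 := h1 N
  rwa [h.fil_eq_of_pow_le ((Ideal.pow_le_pow_right (by omega)).trans hN)] at h2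

end IsPrimaryTo

theorem exists_piece_notMem {J K L : Ideal (S k)} {z : S k} (hz : z.IsHomogeneous 1) (hzL : z ∉ L)
    (hJ : J.IsHomogeneous (homogeneousSubmodule (Fin 4) k))
    (hK : K.IsHomogeneous (homogeneousSubmodule (Fin 4) k))
    (hsat : ∀ s f : S k, s ∉ L → s * f ∈ K → f ∈ K) (hL : L.IsPrime) (hJK : ¬ J ≤ K) :
    ∃ m, ∀ n ≥ m, ∃ f ∈ piece J n, f ∉ K := by
  obtain ⟨f, hfJ, hfK⟩ := Set.not_subset.1 hJK
  obtain ⟨m, hm⟩ : ∃ m, homogeneousComponent m f ∉ K := by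
    by_contra! hall
    exact hfK ((mem_iff_homogeneousComponent_mem hK f).2 hall)
  refine ⟨m, fun n hn => ⟨z ^ (n - m) * homogeneousComponent m f,
    ⟨J.mul_mem_left _ (component_mem hJ hfJ m), ?_⟩, fun hmem => hm (hsat _ _ ?_ hmem)⟩⟩
  · have h1 := (hz.pow (n - m)).mul (homogeneousComponent_isHomogeneous m f)
    rwa [one_mul, Nat.sub_add_cancel hn] at h1
  · exact fun hmem => hzL (hL.mem_of_pow_mem _ hmem)

theorem exists_const_of_eventually_succ {F : ℕ → ℤ}
    (hF : ∀ᶠ n in atTop, F (n + 1) = F n + 1) : ∃ δ : ℤ, ∀ᶠ n : ℕ in atTop, F n = n + 1 + δ := by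
  obtain ⟨m, hm⟩ := eventually_atTop.1 hF
  refine ⟨F m - m - 1, eventually_atTop.2 ⟨m, fun n hn => ?_⟩⟩
  induction n, hn using Nat.le_induction with
  | base => ring
  | succ n hn ih => rw [hm n hn, ih]; push_cast; ring

section growth

variable [IsAlgClosed k] {ℓ τ : Fin 4 → S k} (c : Coords ℓ τ) {I : Ideal (S k)}
  (h : IsPrimaryTo I (Ideal.span {ℓ 2, ℓ 3}))
include c h

theorem eventually_gradedDim_lt {J : Ideal (S k)} {j : ℕ}
    (hJ : J.IsHomogeneous (homogeneousSubmodule (Fin 4) k))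
    (hJK : ¬ J ≤ cmFil I (Ideal.span {ℓ 2, ℓ 3}) j) :
    ∀ᶠ n in atTop, gradedDim J (cmFil I (Ideal.span {ℓ 2, ℓ 3}) j) n <
      gradedDim J (cmFil I (Ideal.span {ℓ 2, ℓ 3}) j) (n + 1) := by
  obtain ⟨m, hm⟩ := exists_piece_notMem (c.isHomogeneous 1) c.one_notMem_line hJ
    (h.fil_isHomogeneous j) (fun s f => h.fil_saturated) h.isPrime hJK
  refine eventually_atTop.2 ⟨m, fun n hn => gradedDim_lt_succ (c.isHomogeneous 1)
    (c.isHomogeneous 0) (fun f => h.fil_saturated c.one_notMem_line)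
    (fun a f => h.fil_saturated (c.pencil_notMem_line a)) (hm n hn)⟩

/-- If `S / I` has multiplicity `d` and `L ^ (d - 1)` is not contained in `I`, then the
filtration has exactly `d` steps, and all the quotients have rank one: every non-zero step
contributes at least one to the growth of the Hilbert function. -/
theorem rank_one_of_not_pow_le {d : ℕ} {e : ℤ}
    (hd : ∀ᶠ n : ℕ in atTop, (gradedDim ⊤ I n : ℤ) = n * d + e)
    (hpow : ∀ j < d, ¬ Ideal.span {ℓ 2, ℓ 3} ^ j ≤ I) :
    Ideal.span {ℓ 2, ℓ 3} ^ d ≤ I ∧ ∃ δ : ℕ → ℤ, ∑ j ∈ Finset.range d, δ j = e - d ∧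
      ∀ j < d, ∀ᶠ n : ℕ in atTop, hilb (cmFil I (Ideal.span {ℓ 2, ℓ 3}) j) n -
        hilb (cmFil I (Ideal.span {ℓ 2, ℓ 3}) (j + 1)) n = n + 1 + δ j := by
  classical
  set L := Ideal.span {ℓ 2, ℓ 3} with hL
  obtain ⟨m, hm, hmin⟩ : ∃ m, L ^ m ≤ I ∧ ∀ j < m, ¬ L ^ j ≤ I :=
    ⟨_, Nat.find_spec h.exists_pow_le, fun j hj => Nat.find_min h.exists_pow_le hj⟩
  have hdm : d ≤ m := by
    by_contra hlt
    exact hpow m (not_le.1 hlt) hm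
  let F : ℕ → ℕ → ℤ := fun j n => hilb (cmFil I L j) n - hilb (cmFil I L (j + 1)) n
  have hgrow : ∀ j ∈ Finset.range m, ∀ᶠ n in atTop, 1 ≤ F j (n + 1) - F j n := by
    intro j hj
    have h1 : ¬ cmFil I L j ≤ cmFil I L (j + 1) := fun hle =>
      hmin j (Finset.mem_range.1 hj) (h.pow_le_of_pow_le_fil_succ ((h.pow_le_fil j).trans hle))
    filter_upwards [eventually_gradedDim_lt c h (h.fil_isHomogeneous j) h1] with n hn
    have h4 : gradedDim (cmFil I L j) (cmFil I L (j + 1)) n <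
      gradedDim (cmFil I L j) (cmFil I L (j + 1)) (n + 1) := hn
    have h2 := gradedDim_eq_sub (h.fil_succ_le j) n
    have h3 := gradedDim_eq_sub (h.fil_succ_le j) (n + 1)
    simp only [F]
    omega
  have hsum : ∀ n, ∑ j ∈ Finset.range m, F j n = gradedDim ⊤ I n := by
    intro n
    simp only [F]
    rw [Finset.sum_range_sub', h.fil_zero, h.fil_eq_of_pow_le hm, gradedDim_eq_sub le_top]
  have hd' : ∀ᶠ n : ℕ in atTop, (gradedDim ⊤ I (n + 1) : ℤ) = (n + 1 : ℕ) * d + e :=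
    (tendsto_add_atTop_nat 1).eventually hd
  have hall : ∀ᶠ n in atTop, ∀ j ∈ Finset.range m, 1 ≤ F j (n + 1) - F j n :=
    (Filter.eventually_all_finset _).2 hgrow
  have htotal : ∀ᶠ n in atTop, ∑ j ∈ Finset.range m, (F j (n + 1) - F j n) = d := by
    filter_upwards [hd, hd'] with n h1 h2
    rw [Finset.sum_sub_distrib, hsum, hsum, h1, h2]
    push_cast
    ring
  have hmd : m ≤ d := by
    obtain ⟨n, h1, h2⟩ := (hall.and htotal).exists
    have h3 := Finset.card_nsmul_le_sum (Finset.range m) _ 1 h1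
    rw [h2, Finset.card_range, nsmul_one] at h3
    exact_mod_cast h3
  obtain rfl : m = d := le_antisymm hmd hdm
  have hone : ∀ j < m, ∀ᶠ n in atTop, F j (n + 1) = F j n + 1 := by
    intro j hj
    filter_upwards [hall, htotal] with n h1 h2
    have h3 : ∑ i ∈ Finset.range m, (1 : ℤ) = ∑ i ∈ Finset.range m, (F i (n + 1) - F i n) := by
      rw [h2]
      simp
    have h4 := (Finset.sum_eq_sum_iff_of_le h1).1 h3 j (Finset.mem_range.2 hj)
    omega
  have hex : ∀ j, ∃ δ : ℤ, j < m → ∀ᶠ n : ℕ in atTop, F j n = n + 1 + δ := by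
    intro j
    by_cases hj : j < m
    · obtain ⟨δ, hδ⟩ := exists_const_of_eventually_succ (hone j hj)
      exact ⟨δ, fun _ => hδ⟩
    · exact ⟨0, fun h => absurd h hj⟩
  choose δ hδ using hex
  refine ⟨hm, δ, ?_, hδ⟩
  have hall' : ∀ᶠ n : ℕ in atTop, ∀ j ∈ Finset.range m, F j n = n + 1 + δ j :=
    (Filter.eventually_all_finset _).2 fun j hj => hδ j (Finset.mem_range.1 hj)
  obtain ⟨n, h1, h2⟩ := (hall'.and hd).exists
  have h3 := hsum n
  rw [Finset.sum_congr rfl h1, h2, Finset.sum_add_distrib] at h3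
  simp only [Finset.sum_const, Finset.card_range, nsmul_eq_mul] at h3
  linarith

end growth

/-! ### The conormal relation of the double line -/

theorem hilb_top_sub_of_prime_to_line {ℓ τ : Fin 4 → S k} (c : Coords ℓ τ) {g : S k} {e : ℕ}
    (hg : g.IsHomogeneous e) (hgL : g ∉ Ideal.span {ℓ 2, ℓ 3})
    (hL : (Ideal.span {ℓ 2, ℓ 3}).IsHomogeneous (homogeneousSubmodule (Fin 4) k)) (n : ℕ) :
    hilb (⊤ : Ideal (S k)) (n + e) - hilb (Ideal.span {ℓ 2, ℓ 3} ⊔ Ideal.span {g}) (n + e) = e := by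
  have h1 := hilb_mul_sup hg (fun h0 => hgL (h0 ▸ Ideal.zero_mem _)) (Ideal.IsHomogeneous.top _) hL
    (K := Ideal.span {ℓ 2, ℓ 3})
    (fun f => ⟨fun hf => ⟨trivial, Ideal.mul_mem_left _ _ hf⟩,
      fun hf => (c.line_isPrime.mem_or_mem hf.2).resolve_left hgL⟩) n
  rw [Ideal.mul_top, sup_comm, c.hilb_line] at h1
  have h2 := c.hilb_line (n + e)
  push_cast at h2
  omega

/-- The conormal module of a line has rank two, hence it is not equal to `ℐ_L / ℐ_{C₂}` if the
latter has rank one. -/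
theorem not_fil_two_le {ℓ τ : Fin 4 → S k} (c : Coords ℓ τ) {I : Ideal (S k)}
    (h : IsPrimaryTo I (Ideal.span {ℓ 2, ℓ 3})) {δ : ℤ}
    (hδ : ∀ᶠ n : ℕ in atTop, hilb (cmFil I (Ideal.span {ℓ 2, ℓ 3}) 1) n -
        hilb (cmFil I (Ideal.span {ℓ 2, ℓ 3}) 2) n = n + 1 + δ) :
    ¬ cmFil I (Ideal.span {ℓ 2, ℓ 3}) 2 ≤ Ideal.span {ℓ 2, ℓ 3} ^ 2 := by
  intro hle
  rw [h.fil_one, le_antisymm hle (h.pow_le_fil 2)] at hδ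
  have hL2 := isHomogeneous_pow h.line_isHomogeneous 2
  have h2 : ℓ 2 ∈ Ideal.span {ℓ 2, ℓ 3} := Ideal.subset_span (by simp)
  have h3 : ℓ 3 ∈ Ideal.span {ℓ 2, ℓ 3} := Ideal.subset_span (by simp)
  have hmul : ∀ a b : S k, a ∈ Ideal.span {ℓ 2, ℓ 3} → b ∈ Ideal.span {ℓ 2, ℓ 3} →
      a * b ∈ Ideal.span {ℓ 2, ℓ 3} ^ 2 := fun a b ha hb => by
    rw [pow_two]; exact Ideal.mul_mem_mul ha hb
  have hne2 : ℓ 2 ≠ 0 := fun h0 => c.two_pow_notMem 1 (by rw [h0]; simp)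
  have hne3 : ℓ 3 ≠ 0 := fun h0 => c.swap.two_pow_notMem 1 (by
    change ℓ 3 ^ 1 ∈ _
    rw [h0]; simp)
  have key2 : ∀ n, hilb (Ideal.span {ℓ 2} ⊔ Ideal.span {ℓ 2, ℓ 3} ^ 2) (n + 1) -
      hilb (Ideal.span {ℓ 2, ℓ 3} ^ 2) (n + 1) = n + 1 := by
    intro n
    rw [← c.hilb_line n, ← hilb_mul_sup (c.isHomogeneous 2) hne2 (Ideal.IsHomogeneous.top _) hL2
      (K := Ideal.span {ℓ 2, ℓ 3}) (fun f => ⟨fun hf => ⟨trivial, hmul _ _ h2 hf⟩, fun hf => ?_⟩) n,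
      Ideal.mul_top]
    refine c.mem_of_relation_two (g := 0) ?_
    rw [zero_mul, sub_zero, mul_comm]
    exact hf.2
  have key3 : ∀ n, hilb (Ideal.span {ℓ 2, ℓ 3}) (n + 1) -
      hilb (Ideal.span {ℓ 2} ⊔ Ideal.span {ℓ 2, ℓ 3} ^ 2) (n + 1) = n + 1 := by
    intro n
    rw [← c.hilb_line n, ← hilb_mul_sup (c.isHomogeneous 3) hne3 (Ideal.IsHomogeneous.top _)
      (Ideal.IsHomogeneous.sup (isHomogeneous_span_singleton (c.isHomogeneous 2)) hL2)
      (K := Ideal.span {ℓ 2, ℓ 3})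
      (fun f => ⟨fun hf => ⟨trivial, Ideal.mem_sup_right (hmul _ _ h3 hf)⟩, fun hf => ?_⟩) n,
      Ideal.mul_top]
    · congr 2
      refine le_antisymm ?_ (sup_le ?_ (sup_le ?_ (Ideal.pow_le_self two_ne_zero)))
      · rw [Ideal.span_le]
        rintro x (rfl | rfl)
        · exact Ideal.mem_sup_right (Ideal.mem_sup_left (Ideal.mem_span_singleton_self _))
        · exact Ideal.mem_sup_left (Ideal.mem_span_singleton_self _)
      · exact (Ideal.span_singleton_le_iff_mem _).2 h3
      · exact (Ideal.span_singleton_le_iff_mem _).2 h2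
    · obtain ⟨a, ha, b, hb, hab⟩ := Submodule.mem_sup.1 hf.2
      obtain ⟨p, rfl⟩ := Ideal.mem_span_singleton'.1 ha
      refine c.mem_of_relation_three (f := p) (g := f) ?_
      have h4 : p * ℓ 2 - f * ℓ 3 = -b := by
        rw [mul_comm f, ← hab]; ring
      rw [h4]
      exact neg_mem hb
  obtain ⟨m, hm⟩ := eventually_atTop.1 hδ
  have e1 := hm (m + 1) (by omega)
  have e2 := hm (m + 1 + 1) (by omega)
  have e3 := key2 m
  have e4 := key3 m
  have e5 := key2 (m + 1)
  have e6 := key3 (m + 1)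
  push_cast at *
  omega

/-- A primitive relation `f ℓ₂ = g ℓ₃` between the conormal vectors `ℓ₂, ℓ₃`, with `f, g` coprime
binary forms of degree `e`, that defines the second member `C₂` of the filtration. -/
structure ConormalRelation (ℓ : Fin 4 → S k) (I : Ideal (S k)) (e : ℕ)
    (f g : MvPolynomial (Fin 2) k) : Prop where
  left_isHomogeneous : f.IsHomogeneous e
  right_isHomogeneous : g.IsHomogeneous e
  isRelPrime : IsRelPrime f g
  mem : lineExtend ℓ f * ℓ 2 - lineExtend ℓ g * ℓ 3 ∈ cmFil I (Ideal.span {ℓ 2, ℓ 3}) 2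
  le : cmFil I (Ideal.span {ℓ 2, ℓ 3}) 2 ≤ Ideal.span {ℓ 2, ℓ 3} ^ 2 ⊔
    Ideal.span {lineExtend ℓ f * ℓ 2 - lineExtend ℓ g * ℓ 3}

theorem ConormalRelation.swap {ℓ : Fin 4 → S k} {I : Ideal (S k)} {e : ℕ}
    {f g : MvPolynomial (Fin 2) k} (hr : ConormalRelation ℓ I e f g) :
    ConormalRelation ![ℓ 0, ℓ 1, ℓ 3, ℓ 2] I e g f := by
  have h1 : lineExtend (![ℓ 0, ℓ 1, ℓ 3, ℓ 2] : Fin 4 → S k) = lineExtend ℓ := rfl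
  have h2 : (Ideal.span {(![ℓ 0, ℓ 1, ℓ 3, ℓ 2] : Fin 4 → S k) 2,
      (![ℓ 0, ℓ 1, ℓ 3, ℓ 2] : Fin 4 → S k) 3}) = Ideal.span {ℓ 2, ℓ 3} :=
    congrArg Ideal.span (Set.pair_comm _ _)
  have h3 : lineExtend ℓ g * (![ℓ 0, ℓ 1, ℓ 3, ℓ 2] : Fin 4 → S k) 2 -
      lineExtend ℓ f * (![ℓ 0, ℓ 1, ℓ 3, ℓ 2] : Fin 4 → S k) 3 =
      -(lineExtend ℓ f * ℓ 2 - lineExtend ℓ g * ℓ 3) := by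
    rw [neg_sub]; rfl
  refine ⟨hr.right_isHomogeneous, hr.left_isHomogeneous, hr.isRelPrime.symm, ?_, ?_⟩
  · rw [h1, h2, h3]
    exact neg_mem hr.mem
  · rw [h1, h2, h3, Ideal.span_singleton_neg]
    exact hr.le

section relation

variable {ℓ τ : Fin 4 → S k} (c : Coords ℓ τ)
include c

theorem Coords.extend_homogeneousComponent (f : MvPolynomial (Fin 2) k) (n : ℕ) :
    homogeneousComponent n (lineExtend ℓ f) = lineExtend ℓ (homogeneousComponent n f) := by
  conv_lhs => rw [← sum_homogeneousComponent f, map_sum, map_sum]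
  have h1 : ∀ i, homogeneousComponent n (lineExtend ℓ (homogeneousComponent i f)) =
      if i = n then lineExtend ℓ (homogeneousComponent n f) else 0 := by
    intro i
    rw [homogeneousComponent_of_mem ((mem_homogeneousSubmodule _ _).2
      (c.extend_isHomogeneous (homogeneousComponent_isHomogeneous i f)))]
    by_cases hi : i = n
    · subst hi; simp
    · rw [if_neg hi, if_neg (Ne.symm hi)]
  simp only [h1, Finset.sum_ite_eq', Finset.mem_range]
  split_ifs with hn
  · rfl
  · rw [homogeneousComponent_eq_zero _ _ (by omega), map_zero]

theorem Coords.extend_notMem {f : MvPolynomial (Fin 2) k} (hf : f ≠ 0) :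
    lineExtend ℓ f ∉ Ideal.span {ℓ 2, ℓ 3} := by
  rwa [c.mem_line_iff, c.restrict_extend]

theorem Coords.mem_sup_of_mul_mem {f g : MvPolynomial (Fin 2) k} (hfg : IsRelPrime f g) {a : S k}
    (ha : a * lineExtend ℓ f ∈ Ideal.span {ℓ 2, ℓ 3} ⊔ Ideal.span {lineExtend ℓ g}) :
    a ∈ Ideal.span {ℓ 2, ℓ 3} ⊔ Ideal.span {lineExtend ℓ g} := by
  obtain ⟨x, hx, y, hy, hxy⟩ := Submodule.mem_sup.1 ha
  obtain ⟨b, rfl⟩ := Ideal.mem_span_singleton'.1 hy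
  have h1 := congrArg (lineRestrict τ) hxy
  rw [map_add, (c.mem_line_iff x).1 hx, zero_add, map_mul, map_mul, c.restrict_extend,
    c.restrict_extend] at h1
  obtain ⟨q, hq⟩ := hfg.symm.dvd_of_dvd_mul_right (Dvd.intro_left _ h1)
  have h2 := c.sub_extend_restrict_mem a
  rw [hq, map_mul] at h2
  rw [← sub_add_cancel a (lineExtend ℓ g * lineExtend ℓ q)]
  exact Submodule.add_mem_sup h2 (Ideal.mul_mem_right _ _ (Ideal.mem_span_singleton_self _))

theorem Coords.exists_relation_of_mem {F : S k} (hF : F ∈ Ideal.span {ℓ 2, ℓ 3}) :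
    ∃ f g, F - (lineExtend ℓ f * ℓ 2 - lineExtend ℓ g * ℓ 3) ∈ Ideal.span {ℓ 2, ℓ 3} ^ 2 := by
  obtain ⟨p, q, rfl⟩ := Ideal.mem_span_pair.1 hF
  refine ⟨lineRestrict τ p, -lineRestrict τ q, ?_⟩
  have h1 : p * ℓ 2 + q * ℓ 3 - (lineExtend ℓ (lineRestrict τ p) * ℓ 2 -
      lineExtend ℓ (-lineRestrict τ q) * ℓ 3) =
      (p - lineExtend ℓ (lineRestrict τ p)) * ℓ 2 + (q - lineExtend ℓ (lineRestrict τ q)) * ℓ 3 := by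
    rw [map_neg]; ring
  rw [h1, pow_two]
  exact add_mem
    (Ideal.mul_mem_mul (c.sub_extend_restrict_mem p) (Ideal.subset_span (by simp)))
    (Ideal.mul_mem_mul (c.sub_extend_restrict_mem q) (Ideal.subset_span (by simp)))

/-- If `ℐ_L / ℐ_{C₂}` has rank one, then `C₂` is defined by a primitive conormal relation: a
non-zero relation can be divided by the greatest common divisor of its coefficients, and any other
relation is a multiple of the result because the rank is positive. -/
theorem exists_conormalRelation {I : Ideal (S k)} (h : IsPrimaryTo I (Ideal.span {ℓ 2, ℓ 3}))
    (hpos : ¬ Ideal.span {ℓ 2, ℓ 3} ≤ cmFil I (Ideal.span {ℓ 2, ℓ 3}) 2)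
    (hlt : ¬ cmFil I (Ideal.span {ℓ 2, ℓ 3}) 2 ≤ Ideal.span {ℓ 2, ℓ 3} ^ 2) :
    ∃ e f g, ConormalRelation ℓ I e f g := by
  set L := Ideal.span {ℓ 2, ℓ 3} with hL
  let H : MvPolynomial (Fin 2) k → MvPolynomial (Fin 2) k → S k :=
    fun f g => lineExtend ℓ f * ℓ 2 - lineExtend ℓ g * ℓ 3
  have hmemH : ∀ F ∈ cmFil I L 2, ∃ f g, F - H f g ∈ L ^ 2 ∧ H f g ∈ cmFil I L 2 := by
    intro F hF
    have hFL : F ∈ L := by rw [← h.fil_one]; exact h.fil_succ_le 1 hF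
    obtain ⟨f, g, hfg⟩ := c.exists_relation_of_mem hFL
    refine ⟨f, g, hfg, ?_⟩
    have h1 := sub_mem hF (h.pow_le_fil 2 hfg)
    rwa [sub_sub_cancel] at h1
  have hprop : ∀ f g f' g', H f g ∈ cmFil I L 2 → H f' g' ∈ cmFil I L 2 → f * g' = f' * g := by
    intro f g f' g' h1 h2
    by_contra hne
    have hx := c.extend_notMem (sub_ne_zero.2 hne)
    apply hpos
    rw [hL, Ideal.span_le]
    rintro x (rfl | rfl)
    · refine h.fil_saturated hx ?_
      have h3 := sub_mem (Ideal.mul_mem_left _ (lineExtend ℓ g') h1)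
        (Ideal.mul_mem_left _ (lineExtend ℓ g) h2)
      convert h3 using 1
      simp only [H, map_sub, map_mul]
      ring
    · refine h.fil_saturated hx ?_
      have h3 := sub_mem (Ideal.mul_mem_left _ (lineExtend ℓ f') h1)
        (Ideal.mul_mem_left _ (lineExtend ℓ f) h2)
      convert h3 using 1
      simp only [H, map_sub, map_mul]
      ring
  obtain ⟨F, hF, hF2⟩ := Set.not_subset.1 hlt
  obtain ⟨f₀, g₀, hFH, hH₀⟩ := hmemH F hF
  have hne : f₀ ≠ 0 ∨ g₀ ≠ 0 := by
    by_contra! hzero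
    apply hF2
    have h1 : H f₀ g₀ = 0 := by simp [H, hzero.1, hzero.2]
    rwa [h1, sub_zero] at hFH
  obtain ⟨f, g, q, hfg, hqf, hqg⟩ : ∃ f g q, IsRelPrime f g ∧ q * f = f₀ ∧ q * g = g₀ := by
    rcases hne with h0 | h0
    · exact UniqueFactorizationMonoid.exists_reduced_factors f₀ h0 g₀
    · exact UniqueFactorizationMonoid.exists_reduced_factors' f₀ g₀ h0
  have hq0 : q ≠ 0 := by
    rintro rfl
    simp only [zero_mul] at hqf hqg
    exact hne.elim (fun h0 => h0 hqf.symm) (fun h0 => h0 hqg.symm)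
  have hH : H f g ∈ cmFil I L 2 := by
    refine h.fil_saturated (c.extend_notMem hq0) ?_
    convert hH₀ using 1
    simp only [H, ← hqf, ← hqg, map_mul]
    ring
  have hfg0 : f ≠ 0 ∨ g ≠ 0 := by
    by_contra! hzero
    rw [hzero.1, hzero.2] at hfg
    exact not_isUnit_zero (hfg dvd_rfl dvd_rfl)
  have hmult : ∀ f' g', H f' g' ∈ cmFil I L 2 → ∃ a, f' = a * f ∧ g' = a * g := by
    intro f' g' h'
    have h1 := hprop f g f' g' hH h'
    by_cases hg : g = 0
    · have hf : f ≠ 0 := hfg0.resolve_right (not_not.2 hg)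
      rw [hg] at hfg h1
      obtain ⟨a, ha⟩ := (isRelPrime_zero_right.1 hfg).dvd (a := f')
      refine ⟨a, by rw [ha, mul_comm], ?_⟩
      rw [mul_zero] at h1
      rw [hg, mul_zero]
      exact (mul_eq_zero.1 h1).resolve_left hf
    · obtain ⟨a, ha⟩ := hfg.symm.dvd_of_dvd_mul_left (Dvd.intro_left _ h1.symm)
      refine ⟨a, mul_right_cancel₀ hg ?_, by rw [ha, mul_comm]⟩
      rw [← h1, ha]
      ring
  have hcomp : ∀ n, H (homogeneousComponent n f) (homogeneousComponent n g) ∈ cmFil I L 2 := by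
    intro n
    have h1 := component_mem (h.fil_isHomogeneous 2) hH (n + 1)
    convert h1 using 1
    simp only [H, map_sub, mul_comm _ (ℓ 2), mul_comm _ (ℓ 3),
      homogeneousComponent_mul_left (c.isHomogeneous _), c.extend_homogeneousComponent]
  -- A non-zero component of `(f, g)` is a multiple of `(f, g)`, so that the degrees agree.
  obtain ⟨n, a, ha0, hfa, hga⟩ : ∃ n a, a ≠ 0 ∧ homogeneousComponent n f = C a * f ∧
      homogeneousComponent n g = C a * g := by
    have aux : ∀ p : MvPolynomial (Fin 2) k, p ≠ 0 → ∃ n, homogeneousComponent n p ≠ 0 ∧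
        ∀ b, homogeneousComponent n p = b * p → ∃ a, a ≠ 0 ∧ b = C a := by
      intro p hp
      obtain ⟨n, hn⟩ : ∃ n, homogeneousComponent n p ≠ 0 := by
        by_contra! hall
        apply hp
        rw [← sum_homogeneousComponent p]
        exact Finset.sum_eq_zero fun i _ => hall i
      refine ⟨n, hn, fun b hb => ?_⟩
      have hb0 : b ≠ 0 := by
        rintro rfl
        rw [zero_mul] at hb
        exact hn hb
      have h1 : n ≤ p.totalDegree := by
        by_contra hlt
        exact hn (homogeneousComponent_eq_zero _ _ (not_le.1 hlt))
      have h2 := (homogeneousComponent_isHomogeneous n p).totalDegree hn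
      rw [hb, totalDegree_mul_of_isDomain hb0 hp] at h2
      have h3 : b.totalDegree = 0 := by omega
      rw [totalDegree_eq_zero_iff_eq_C] at h3
      refine ⟨_, fun h0 => hb0 ?_, h3⟩
      rw [h3, h0, C_0]
    rcases hfg0 with h0 | h0
    · obtain ⟨n, -, hn⟩ := aux f h0
      obtain ⟨b, hb1, hb2⟩ := hmult _ _ (hcomp n)
      obtain ⟨a, ha, rfl⟩ := hn b hb1
      exact ⟨n, a, ha, hb1, hb2⟩
    · obtain ⟨n, -, hn⟩ := aux g h0
      obtain ⟨b, hb1, hb2⟩ := hmult _ _ (hcomp n)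
      obtain ⟨a, ha, rfl⟩ := hn b hb2
      exact ⟨n, a, ha, hb1, hb2⟩
  have hhom : ∀ p : MvPolynomial (Fin 2) k, homogeneousComponent n p = C a * p →
      p.IsHomogeneous n := by
    intro p hp
    have h1 : p = C a⁻¹ * homogeneousComponent n p := by
      rw [hp, ← mul_assoc, ← C_mul, inv_mul_cancel₀ ha0, C_1, one_mul]
    rw [h1]
    exact (homogeneousComponent_isHomogeneous n p).C_mul _
  refine ⟨n, f, g, hhom f hfa, hhom g hga, hfg, hH, fun G hG => ?_⟩
  obtain ⟨f', g', h1, h2⟩ := hmemH G hG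
  obtain ⟨b, rfl, rfl⟩ := hmult f' g' h2
  rw [← sub_add_cancel G (H (b * f) (b * g))]
  refine Submodule.add_mem_sup h1 (Ideal.mem_span_singleton'.2 ⟨lineExtend ℓ b, ?_⟩)
  simp only [H, map_mul]
  ring

end relation

/-! ### The powers of the first line bundle -/

section relation

/-- Let `K` be a filtration that is compatible with the powers of `L = (u, v)`. A relation
`f u = g v` modulo `K 2` makes `u ^ j` a generator of `L ^ j` modulo `K (j + 1)` wherever `g` is
invertible. -/
theorem exists_pow_mul_sub_mem_filtration {R : Type*} [CommRing R] {K : ℕ → Ideal R} {u v f g : R}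
    (hK : ∀ i j, ∀ x ∈ K i, ∀ y ∈ Ideal.span {u, v} ^ j, x * y ∈ K (i + j))
    (hrel : f * u - g * v ∈ K 2) (j : ℕ) {F : R} (hF : F ∈ Ideal.span {u, v} ^ j) :
    ∃ a, g ^ j * F - a * u ^ j ∈ K (j + 1) := by
  have hu : u ∈ Ideal.span {u, v} := Ideal.subset_span (by simp)
  have hv : v ∈ Ideal.span {u, v} := Ideal.subset_span (by simp)
  induction j generalizing F with
  | zero => exact ⟨F, by simp⟩
  | succ j ih =>
    rw [pow_succ] at hF
    refine Submodule.mul_induction_on hF ?_ ?_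
    · intro G hG y hy
      obtain ⟨p, q, rfl⟩ := Ideal.mem_span_pair.1 hy
      obtain ⟨a, ha⟩ := ih hG
      have h1 : g * (p * u + q * v) ∈ Ideal.span {u, v} ^ 1 := by
        rw [pow_one]
        exact Ideal.mul_mem_left _ _ (add_mem (Ideal.mul_mem_left _ _ hu)
          (Ideal.mul_mem_left _ _ hv))
      have h2 := hK _ _ _ ha _ h1
      have h3 := hK _ _ _ hrel _ (Ideal.mul_mem_left _ (a * q) (Ideal.pow_mem_pow hu j))
      rw [show 2 + j = j + 1 + 1 by omega] at h3
      refine ⟨a * (p * g + q * f), ?_⟩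
      convert sub_mem h2 h3 using 1
      ring
    · rintro x y ⟨a, ha⟩ ⟨b, hb⟩
      refine ⟨a + b, ?_⟩
      convert add_mem ha hb using 1
      ring

variable {I L : Ideal (S k)} (h : IsPrimaryTo I L) {u v f g : S k} (hL : L = Ideal.span {u, v})
  (hrel : f * u - g * v ∈ cmFil I L 2)

include h hL hrel in
theorem exists_pow_mul_sub_mem (j : ℕ) {F : S k} (hF : F ∈ L ^ j) :
    ∃ a, g ^ j * F - a * u ^ j ∈ cmFil I L (j + 1) := by
  rw [hL] at hF
  exact exists_pow_mul_sub_mem_filtration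
    (fun i j x hx y hy => h.mul_mem_fil hx (by rwa [hL])) hrel j hF

include h hL hrel in
theorem pow_mul_pow_sub_mem (j : ℕ) :
    g ^ j * v ^ j - f ^ j * u ^ j ∈ cmFil I L (j + 1) := by
  have hu : u ∈ L := hL ▸ Ideal.subset_span (by simp)
  have hv : v ∈ L := hL ▸ Ideal.subset_span (by simp)
  induction j with
  | zero => simp
  | succ j ih =>
    have h2 := h.mul_mem_fil ih (by rw [pow_one]; exact L.mul_mem_left g hv : g * v ∈ L ^ 1)
    have h3 := h.mul_mem_fil hrel (Ideal.mul_mem_left _ (f ^ j) (Ideal.pow_mem_pow hu j))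
    rw [show 2 + j = j + 1 + 1 by omega] at h3
    convert sub_mem h2 h3 using 1
    ring

variable (hg : g ∉ L)

include h hL hrel hg in
theorem pow_notMem_fil {j : ℕ} (hj : ¬ L ^ j ≤ cmFil I L (j + 1)) :
    u ^ j ∉ cmFil I L (j + 1) := by
  intro hu
  apply hj
  intro F hF
  obtain ⟨a, ha⟩ := exists_pow_mul_sub_mem h hL hrel j hF
  have h1 := add_mem ha (Ideal.mul_mem_left _ a hu)
  rw [sub_add_cancel] at h1
  exact h.fil_saturated (fun hmem => hg (h.isPrime.mem_of_pow_mem _ hmem)) h1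

include h hL hrel hg in
theorem mem_fil_of_mul_mem {j : ℕ} (hj : ¬ L ^ (j + 1) ≤ cmFil I L (j + 2)) {F : S k}
    (hF : F ∈ L ^ j) (huF : u * F ∈ cmFil I L (j + 2)) : F ∈ cmFil I L (j + 1) := by
  have hu : u ∈ L := hL ▸ Ideal.subset_span (by simp)
  obtain ⟨a, ha⟩ := exists_pow_mul_sub_mem h hL hrel j hF
  have h1 := h.mul_mem_fil ha (by rwa [pow_one] : u ∈ L ^ 1)
  have h2 : a * u ^ (j + 1) ∈ cmFil I L (j + 2) := by
    convert sub_mem (Ideal.mul_mem_left _ (g ^ j) huF) h1 using 1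
    ring
  have haL : a ∈ L := by
    by_contra haL
    exact pow_notMem_fil h hL hrel hg hj (h.fil_saturated haL h2)
  have h3 : a * u ^ j ∈ cmFil I L (j + 1) := by
    refine h.pow_le_fil _ ?_
    rw [pow_succ' L]
    exact Ideal.mul_mem_mul haL (Ideal.pow_mem_pow hu j)
  have h4 := add_mem ha h3
  rw [sub_add_cancel] at h4
  exact h.fil_saturated (fun hmem => hg (h.isPrime.mem_of_pow_mem _ hmem)) h4

include h hL hrel hg in
/-- The annihilator of `v ^ (j + 1)` in `L ^ (j + 1) / (u L ^ j)`, modulo `ℐ_{C_{j + 2}}`,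
does not depend on `j`. -/
theorem mul_pow_mem_iff
    (hcop : ∀ a, a * f ∈ L ⊔ Ideal.span {g} → a ∈ L ⊔ Ideal.span {g})
    {j : ℕ} (hj : ¬ L ^ (j + 1) ≤ cmFil I L (j + 2)) (a : S k) :
    v ^ (j + 1) * a ∈ Ideal.span {u} * L ^ j ⊔ cmFil I L (j + 2) ↔
      a ∈ L ⊔ Ideal.span {g} := by
  have hu : u ∈ L := hL ▸ Ideal.subset_span (by simp)
  have hv : v ∈ L := hL ▸ Ideal.subset_span (by simp)
  constructor
  · intro ha
    obtain ⟨x, hx, r, hr, hxr⟩ := Submodule.mem_sup.1 ha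
    obtain ⟨F, hF, rfl⟩ := Ideal.mem_span_singleton_mul.1 hx
    obtain ⟨b, hb⟩ := exists_pow_mul_sub_mem h hL hrel j hF
    have h1 := h.mul_mem_fil hb (by rw [pow_one]; exact L.mul_mem_left g hu : g * u ∈ L ^ 1)
    have h2 := Ideal.mul_mem_left _ a (pow_mul_pow_sub_mem h hL hrel (j + 1))
    have h3 := Ideal.mul_mem_left _ (g ^ (j + 1)) hr
    have h4 : (a * f ^ (j + 1) - g * b) * u ^ (j + 1) ∈ cmFil I L (j + 2) := by
      have h5 := add_mem (sub_mem h1 h2) h3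
      convert h5 using 1
      have h6 : r = v ^ (j + 1) * a - u * F := by rw [← hxr]; ring
      rw [h6]
      ring
    have h5 : a * f ^ (j + 1) - g * b ∈ L := by
      by_contra hnot
      exact pow_notMem_fil h hL hrel hg hj (h.fil_saturated hnot h4)
    have h6 : a * f ^ (j + 1) ∈ L ⊔ Ideal.span {g} := by
      rw [← sub_add_cancel (a * f ^ (j + 1)) (g * b)]
      exact Submodule.add_mem_sup h5 (Ideal.mul_mem_right _ _ (Ideal.mem_span_singleton_self g))
    have hpow : ∀ m, a * f ^ m ∈ L ⊔ Ideal.span {g} → a ∈ L ⊔ Ideal.span {g} := by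
      intro m
      induction m with
      | zero => intro hm; simpa using hm
      | succ m ih =>
        intro hm
        rw [pow_succ, ← mul_assoc] at hm
        exact ih (hcop _ hm)
    exact hpow _ h6
  · intro ha
    obtain ⟨x, hx, y, hy, rfl⟩ := Submodule.mem_sup.1 ha
    obtain ⟨b, rfl⟩ := Ideal.mem_span_singleton'.1 hy
    rw [mul_add]
    refine add_mem (Ideal.mem_sup_right (h.pow_le_fil _ ?_)) ?_
    · rw [pow_succ L]
      exact Ideal.mul_mem_mul (Ideal.pow_mem_pow hv _) hx
    · have h1 := h.mul_mem_fil hrel (Ideal.pow_mem_pow hv j)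
      rw [show 2 + j = j + 2 by omega] at h1
      have h2 : v ^ (j + 1) * (b * g) =
          u * (b * f * v ^ j) + (-b) * ((f * u - g * v) * v ^ j) := by ring
      rw [h2]
      exact Submodule.add_mem_sup
        (Ideal.mem_span_singleton_mul.2
          ⟨_, Ideal.mul_mem_left _ _ (Ideal.pow_mem_pow hv j), rfl⟩)
        (Ideal.mul_mem_left _ _ h1)

end relation

theorem span_pair_pow_succ {R : Type*} [CommRing R] (u v : R) (j : ℕ) :
    Ideal.span {u, v} ^ (j + 1) =
      Ideal.span {v ^ (j + 1)} ⊔ Ideal.span {u} * Ideal.span {u, v} ^ j := by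
  have hsup : Ideal.span {u, v} = Ideal.span {u} ⊔ Ideal.span {v} := by
    rw [← Ideal.span_union, Set.singleton_union]
  have hu : Ideal.span {u} ≤ Ideal.span {u, v} := by rw [hsup]; exact le_sup_left
  have hv : Ideal.span {v} ≤ Ideal.span {u, v} := by rw [hsup]; exact le_sup_right
  generalize Ideal.span {u, v} = M at *
  have hmul : ∀ N : Ideal R, M * N = Ideal.span {u} * N ⊔ Ideal.span {v} * N := by
    intro N
    rw [← Ideal.sup_mul, ← hsup]
  induction j with
  | zero => rw [zero_add, pow_one, pow_one, pow_zero, mul_one, hsup, sup_comm]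
  | succ j ih =>
    apply le_antisymm
    · rw [pow_succ' M (j + 1), hmul]
      refine sup_le le_sup_right ?_
      rw [ih, Ideal.mul_sup]
      refine sup_le (le_sup_of_le_left ?_) (le_sup_of_le_right ?_)
      · rw [Ideal.span_singleton_mul_span_singleton, ← pow_succ']
      · rw [mul_left_comm]
        refine Ideal.mul_mono le_rfl ?_
        rw [← ih, pow_succ' M j]
        exact Ideal.mul_mono hv le_rfl
    · refine sup_le ?_ ?_
      · rw [Ideal.span_singleton_le_iff_mem]
        exact Ideal.pow_mem_pow (hv (Ideal.mem_span_singleton_self v)) _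
      · rw [pow_succ' M (j + 1)]
        exact Ideal.mul_mono hu le_rfl

/-- The Hilbert function of the image of `L ^ j` in `ℐ_{C_j} / ℐ_{C_{j + 1}}`, which is the
`j`-th power of the line bundle `𝓛₁`. Multiplication by `ℓ₂` embeds the `j`-th image into the
next one, and the cokernel is cyclic with annihilator `L + (g)`. -/
theorem hilb_pow_sup_fil {ℓ τ : Fin 4 → S k} (c : Coords ℓ τ) {I : Ideal (S k)}
    (h : IsPrimaryTo I (Ideal.span {ℓ 2, ℓ 3})) {e : ℕ} {f g : MvPolynomial (Fin 2) k}
    (hr : ConormalRelation ℓ I e f g) (hg : g ≠ 0) {d : ℕ}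
    (hd : ∀ j < d, ¬ Ideal.span {ℓ 2, ℓ 3} ^ j ≤ cmFil I (Ideal.span {ℓ 2, ℓ 3}) (j + 1))
    {j : ℕ} (hj : j < d) : ∀ᶠ n : ℕ in atTop,
    hilb (Ideal.span {ℓ 2, ℓ 3} ^ j ⊔ cmFil I (Ideal.span {ℓ 2, ℓ 3}) (j + 1)) n -
      hilb (cmFil I (Ideal.span {ℓ 2, ℓ 3}) (j + 1)) n = n + 1 + j * ((e : ℤ) - 1) := by
  induction j with
  | zero =>
    refine Eventually.of_forall fun n => ?_
    rw [zero_add, pow_zero, Ideal.one_eq_top, top_sup_eq, h.fil_one, c.hilb_line]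
    push_cast
    ring
  | succ j ih =>
    have hgL := c.extend_notMem hg
    set L := Ideal.span {ℓ 2, ℓ 3} with hL
    have hne := hd (j + 1) hj
    have hu : ℓ 2 ∈ L := Ideal.subset_span (by simp)
    have hne2 : ℓ 2 ≠ 0 := fun h0 => c.two_pow_notMem 1 (by rw [h0]; simp)
    have hne3 : ℓ 3 ≠ 0 := fun h0 => c.swap.two_pow_notMem 1 (by
      change ℓ 3 ^ 1 ∈ _
      rw [h0]; simp)
    have hJh : (L ^ j ⊔ cmFil I L (j + 1)).IsHomogeneous (homogeneousSubmodule (Fin 4) k) :=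
      Ideal.IsHomogeneous.sup (isHomogeneous_pow h.line_isHomogeneous j) (h.fil_isHomogeneous _)
    have hmulfil : ∀ x ∈ cmFil I L (j + 1), ℓ 2 * x ∈ cmFil I L (j + 2) := by
      intro x hx
      have h1 := h.mul_mem_fil hx (by rwa [pow_one] : ℓ 2 ∈ L ^ 1)
      rwa [mul_comm] at h1
    have hP : Ideal.span {ℓ 2} * (L ^ j ⊔ cmFil I L (j + 1)) ⊔ cmFil I L (j + 2) =
        Ideal.span {ℓ 2} * L ^ j ⊔ cmFil I L (j + 2) := by
      rw [Ideal.mul_sup, sup_assoc]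
      congr 1
      rw [sup_eq_right, Ideal.span_singleton_mul_le_iff]
      exact hmulfil
    have hPh : (Ideal.span {ℓ 2} * L ^ j ⊔ cmFil I L (j + 2)).IsHomogeneous
        (homogeneousSubmodule (Fin 4) k) :=
      Ideal.IsHomogeneous.sup
        (Ideal.IsHomogeneous.mul (isHomogeneous_span_singleton (c.isHomogeneous 2))
          (isHomogeneous_pow h.line_isHomogeneous j)) (h.fil_isHomogeneous _)
    have step1 : ∀ n, hilb (Ideal.span {ℓ 2} * L ^ j ⊔ cmFil I L (j + 2)) (n + 1) -
        hilb (cmFil I L (j + 2)) (n + 1) =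
        hilb (L ^ j ⊔ cmFil I L (j + 1)) n - hilb (cmFil I L (j + 1)) n := by
      intro n
      rw [← hP]
      refine hilb_mul_sup (c.isHomogeneous 2) hne2 hJh (h.fil_isHomogeneous _) (fun x => ?_) n
      refine ⟨fun hx => ⟨Ideal.mem_sup_right hx, hmulfil x hx⟩, fun hx => ?_⟩
      obtain ⟨y, hy, z, hz, rfl⟩ := Submodule.mem_sup.1 hx.1
      refine add_mem (mem_fil_of_mul_mem h hL hr.mem hgL hne hy ?_) hz
      have h1 := sub_mem hx.2 (hmulfil z hz)
      rwa [mul_add, add_sub_cancel_right] at h1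
    have hPsup : Ideal.span {ℓ 3 ^ (j + 1)} * ⊤ ⊔
        (Ideal.span {ℓ 2} * L ^ j ⊔ cmFil I L (j + 2)) = L ^ (j + 1) ⊔ cmFil I L (j + 2) := by
      rw [Ideal.mul_top, ← sup_assoc, hL, ← span_pair_pow_succ]
    have step2 : ∀ n, hilb (L ^ (j + 1) ⊔ cmFil I L (j + 2)) (n + (j + 1)) -
        hilb (Ideal.span {ℓ 2} * L ^ j ⊔ cmFil I L (j + 2)) (n + (j + 1)) =
        hilb (⊤ : Ideal (S k)) n - hilb (L ⊔ Ideal.span {lineExtend ℓ g}) n := by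
      intro n
      rw [← hPsup]
      have h3 : (ℓ 3 ^ (j + 1)).IsHomogeneous (j + 1) := by
        have := (c.isHomogeneous 3).pow (j + 1)
        rwa [one_mul] at this
      refine hilb_mul_sup h3 (pow_ne_zero _ hne3) (Ideal.IsHomogeneous.top _) hPh (fun x => ?_) n
      rw [mul_pow_mem_iff h hL hr.mem hgL (fun a => c.mem_sup_of_mul_mem hr.isRelPrime) hne]
      simp
    obtain ⟨m, hm⟩ := eventually_atTop.1 (ih (by omega))
    refine eventually_atTop.2 ⟨m + e + j + 1, fun n hn => ?_⟩
    obtain ⟨i, rfl⟩ := Nat.exists_eq_add_of_le hn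
    have e1 := step2 (m + i + e)
    rw [hilb_top_sub_of_prime_to_line c (c.extend_isHomogeneous hr.right_isHomogeneous) hgL
      h.line_isHomogeneous] at e1
    have e2 := step1 (m + i + e + j)
    rw [hm _ (by omega)] at e2
    rw [show m + e + j + 1 + i = m + i + e + (j + 1) by omega]
    rw [show m + i + e + j + 1 = m + i + e + (j + 1) by omega] at e2
    rw [show j + 1 + 1 = j + 2 by omega]
    push_cast at e1 e2 ⊢
    linarith

/-! ### The rank one filtration and its degrees -/

theorem homIdeal_isHomogeneous (C : (P3 k).IdealSheafData) :
    (homIdeal C).IsHomogeneous (homogeneousSubmodule (Fin 4) k) :=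
  Ideal.homogeneous_span _ _ (by rintro f ⟨n, hf, -⟩; exact ⟨n, hf⟩)

/-- A prime ideal that strictly contains the ideal of a line has a quotient of dimension at most
one. -/
theorem Coords.ringKrullDim_quotient_ne_two {ℓ τ : Fin 4 → S k} (c : Coords ℓ τ)
    {P : Ideal (S k)} (hLP : Ideal.span {ℓ 2, ℓ 3} ≤ P) {s : S k} (hsP : s ∈ P)
    (hsL : s ∉ Ideal.span {ℓ 2, ℓ 3}) : ringKrullDim (S k ⧸ P) ≠ 2 := by
  let φ : MvPolynomial (Fin 2) k →+* S k ⧸ P :=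
    (Ideal.Quotient.mk P).comp (lineExtend ℓ).toRingHom
  have hmk : ∀ f : S k, φ (lineRestrict τ f) = Ideal.Quotient.mk P f := fun f =>
    (Ideal.Quotient.eq.2 (hLP (c.sub_extend_restrict_mem f))).symm
  have hsurj : Function.Surjective φ := by
    intro x
    obtain ⟨f, rfl⟩ := Ideal.Quotient.mk_surjective x
    exact ⟨_, hmk f⟩
  have h0 : lineRestrict τ s ≠ 0 := fun h0 => hsL ((c.mem_line_iff s).2 h0)
  have h1 := ringKrullDim_succ_le_of_surjective φ hsurj
    (mem_nonZeroDivisors_of_ne_zero h0) (by rw [hmk, Ideal.Quotient.eq_zero_iff_mem]; exact hsP)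
  rw [MvPolynomial.ringKrullDim_of_isNoetherianRing, ringKrullDim_eq_zero_of_field,
    Nat.card_eq_fintype_card, Fintype.card_fin, zero_add] at h1
  intro h2
  rw [h2] at h1
  exact absurd h1 (by decide)

/-- The homogeneous ideal of a curve supported on a line is primary to the ideal of the line. -/
theorem IsMultipleLine.isPrimaryTo {C : (P3 k).IdealSheafData} {d : ℕ} {g : ℤ}
    (hC : IsMultipleLine C d g) {ℓ τ : Fin 4 → S k} (c : Coords ℓ τ)
    (hL : supportIdeal C = Ideal.span {ℓ 2, ℓ 3}) :
    IsPrimaryTo (homIdeal C) (Ideal.span {ℓ 2, ℓ 3}) where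
  isPrime := c.line_isPrime
  line_isHomogeneous := Ideal.homogeneous_span _ _ (by
    rintro f (rfl | rfl)
    · exact ⟨1, c.isHomogeneous 2⟩
    · exact ⟨1, c.isHomogeneous 3⟩)
  isHomogeneous := homIdeal_isHomogeneous C
  le := hL ▸ Ideal.le_radical
  exists_pow_le := by
    rw [← hL]
    exact Ideal.exists_radical_pow_le_of_fg _ (IsNoetherian.noetherian _)
  saturated := by
    intro s f hs hsf
    by_contra hf
    have hf0 : Ideal.Quotient.mk (homIdeal C) f ≠ 0 := fun h0 =>
      hf (Ideal.Quotient.eq_zero_iff_mem.1 h0)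
    obtain ⟨P, hP, hle⟩ := exists_le_isAssociatedPrime_of_isNoetherianRing (S k) _ hf0
    have hmem : ∀ a : S k, a * f ∈ homIdeal C → a ∈ P := by
      intro a ha
      refine hle ?_
      rw [Submodule.mem_colon_singleton, Submodule.mem_bot]
      exact Ideal.Quotient.eq_zero_iff_mem.2 ha
    have hLP : Ideal.span {ℓ 2, ℓ 3} ≤ P := by
      rw [← hL]
      exact (hP.isPrime.radical_le_iff).2 fun a ha =>
        hmem a (Ideal.mul_mem_right _ _ ha)
    exact c.ringKrullDim_quotient_ne_two hLP (hmem s hsf) hs (hC.isCurve.2 P hP)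

/-- The structure of a `C_{d,ℓ}`: in suitable coordinates, all the quotients of its
Cohen-Macaulay filtration have rank one, with degrees `δ j`, and `C₂` is defined by a primitive
conormal relation with `g ≠ 0`. -/
structure RankOneFiltration (I : Ideal (S k)) (d e : ℕ) (ℓ τ : Fin 4 → S k)
    (f g : MvPolynomial (Fin 2) k) (δ : ℕ → ℤ) : Prop where
  coords : Coords ℓ τ
  isPrimaryTo : IsPrimaryTo I (Ideal.span {ℓ 2, ℓ 3})
  relation : ConormalRelation ℓ I e f g
  ne_zero : g ≠ 0
  not_pow_le : ∀ j < d, ¬ Ideal.span {ℓ 2, ℓ 3} ^ j ≤ cmFil I (Ideal.span {ℓ 2, ℓ 3}) (j + 1)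
  pow_le : Ideal.span {ℓ 2, ℓ 3} ^ d ≤ I
  degree : ∀ j < d, ∀ᶠ n : ℕ in atTop, hilb (cmFil I (Ideal.span {ℓ 2, ℓ 3}) j) n -
        hilb (cmFil I (Ideal.span {ℓ 2, ℓ 3}) (j + 1)) n = n + 1 + δ j

theorem IsC.exists_rankOneFiltration [IsAlgClosed k] {d l : ℕ} (hd : 2 ≤ d)
    {C : (P3 k).IdealSheafData} (hC : IsC d l C) :
    ∃ e ℓ τ f g δ, supportIdeal C = Ideal.span {ℓ 2, ℓ 3} ∧
      RankOneFiltration (homIdeal C) d e ℓ τ f g δ ∧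
      ∑ j ∈ Finset.range d, δ j = (d.choose 3 : ℤ) + l * (d.choose 2 : ℤ) := by
  obtain ⟨u, v, hu, hv, huv, hLuv⟩ := hC.multipleLine.isLine
  obtain ⟨ℓ, τ, c, rfl, rfl⟩ := exists_coords hu hv huv
  have h := hC.multipleLine.isPrimaryTo c hLuv
  have hpow : ∀ j < d, ¬ Ideal.span {ℓ 2, ℓ 3} ^ j ≤ homIdeal C := by
    intro j hj hle
    have h2 : ℓ 2 ∈ Ideal.span {ℓ 2, ℓ 3} := Ideal.subset_span (by simp)
    have h1 : ℓ 2 ^ (d - 1) * ℓ 1 ^ l ∈ piece (homIdeal C) (l + d - 1) := by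
      refine ⟨Ideal.mul_mem_right _ _ (hle (Ideal.pow_le_pow_right (by omega : j ≤ d - 1)
        (Ideal.pow_mem_pow h2 _))), ?_⟩
      have := ((c.isHomogeneous 2).pow (d - 1)).mul ((c.isHomogeneous 1).pow l)
      rw [one_mul, one_mul, show d - 1 + l = l + d - 1 by omega] at this
      exact this
    rw [hC.sections_eq, hLuv] at h1
    have h3 : ℓ 2 ^ (d - 1) * ℓ 1 ^ l ∈ Ideal.span {ℓ 2, ℓ 3} ^ (d - 1 + 0 + 1) := by
      rw [show d - 1 + 0 + 1 = d by omega]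
      exact h1.1
    have h5 : ℓ 1 ^ l ∈ Ideal.span {ℓ 2, ℓ 3} ^ 0 := by
      rw [pow_zero, Ideal.one_eq_top]
      trivial
    rcases c.mem_or_mem_of_mul_mem (Ideal.pow_mem_pow h2 (d - 1)) h5 h3 with h4 | h4
    · exact c.two_pow_notMem _ h4
    · rw [zero_add, pow_one] at h4
      exact c.one_notMem_line (c.line_isPrime.mem_of_pow_mem _ h4)
  obtain ⟨hle, δ, hsum, hδ⟩ := rank_one_of_not_pow_le c h (d := d)
    (e := 1 - (-((d : ℤ) - 1) - (d.choose 3 : ℤ) - (l : ℤ) * (d.choose 2 : ℤ)))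
    (hC.multipleLine.degreeGenus.mono fun n hn => by rw [hn]; ring) hpow
  have hne : ∀ j < d, ¬ Ideal.span {ℓ 2, ℓ 3} ^ j ≤
      cmFil (homIdeal C) (Ideal.span {ℓ 2, ℓ 3}) (j + 1) :=
    fun j hj hle' => hpow j hj (h.pow_le_of_pow_le_fil_succ hle')
  have hsum' : ∑ j ∈ Finset.range d, δ j = (d.choose 3 : ℤ) + l * (d.choose 2 : ℤ) := by
    rw [hsum]; ring
  obtain ⟨e, f, g, hr⟩ := exists_conormalRelation c h
    (by simpa using hne 1 (by omega)) (not_fil_two_le c h (hδ 1 (by omega)))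
  by_cases hg : g = 0
  · have hf : f ≠ 0 := by
      rintro rfl
      have := hr.isRelPrime
      rw [hg] at this
      exact not_isUnit_zero (this dvd_rfl dvd_rfl)
    have hswap : Ideal.span {(![ℓ 0, ℓ 1, ℓ 3, ℓ 2] : Fin 4 → S k) 2,
      (![ℓ 0, ℓ 1, ℓ 3, ℓ 2] : Fin 4 → S k) 3} = Ideal.span {ℓ 2, ℓ 3} :=
      congrArg Ideal.span (Set.pair_comm _ _)
    refine ⟨e, _, _, g, f, δ, hLuv.trans hswap.symm, ⟨c.swap, ?_, hr.swap, hf, ?_, ?_, ?_⟩, hsum'⟩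
    · rwa [hswap]
    · rwa [hswap]
    · rwa [hswap]
    · rwa [hswap]
  · exact ⟨e, ℓ, τ, f, g, δ, hLuv, ⟨c, h, hr, hg, hne, hle, hδ⟩, hsum'⟩

theorem hasRankDegree_unique {J I : Ideal (S k)} {r : ℕ} {e e' : ℤ} (h : HasRankDegree J I r e)
    (h' : HasRankDegree J I r e') : e = e' := by
  obtain ⟨n, h1, h2⟩ := (h.and h').exists
  rw [h1] at h2
  linarith

theorem hasRankDegree_zero_nonneg {J I : Ideal (S k)} {e : ℤ} (h : HasRankDegree J I 0 e) :
    0 ≤ e := by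
  obtain ⟨n, hn⟩ := Eventually.exists h
  have h1 : (0 : ℤ) ≤ gradedDim J I n := Int.natCast_nonneg _
  rw [hn] at h1
  simpa using h1

namespace RankOneFiltration

variable {I : Ideal (S k)} {d e : ℕ} {ℓ τ : Fin 4 → S k} {f g : MvPolynomial (Fin 2) k}
  {δ : ℕ → ℤ} (F : RankOneFiltration I d e ℓ τ f g δ)
include F

theorem degree_zero (hd : 2 ≤ d) : δ 0 = 0 := by
  obtain ⟨n, hn⟩ := (F.degree 0 (by omega)).exists
  rw [F.isPrimaryTo.fil_zero, zero_add, F.isPrimaryTo.fil_one, F.coords.hilb_line] at hn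
  linarith

theorem degree_one (hd : 2 ≤ d) : δ 1 = (e : ℤ) - 1 := by
  obtain ⟨n, h1, h2⟩ := ((F.degree 1 (by omega)).and
    (hilb_pow_sup_fil F.coords F.isPrimaryTo F.relation F.ne_zero F.not_pow_le
      (j := 1) (by omega))).exists
  have h3 : cmFil I (Ideal.span {ℓ 2, ℓ 3}) (1 + 1) ≤ Ideal.span {ℓ 2, ℓ 3} := by
    have := F.isPrimaryTo.fil_succ_le 1
    rwa [F.isPrimaryTo.fil_one] at this
  rw [pow_one, sup_eq_left.2 h3] at h2
  rw [F.isPrimaryTo.fil_one, h2] at h1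
  push_cast at h1
  linarith

theorem hasRankDegree_one (hd : 2 ≤ d) :
    HasRankDegree (cmFil I (Ideal.span {ℓ 2, ℓ 3}) 1) (cmFil I (Ideal.span {ℓ 2, ℓ 3}) 2) 1
      ((e : ℤ) - 1) := by
  filter_upwards [F.degree 1 (by omega)] with n hn
  rw [gradedDim_eq_sub (F.isPrimaryTo.fil_succ_le 1), hn, F.degree_one hd]
  push_cast
  ring

theorem sup_le_fil (j : ℕ) : Ideal.span {ℓ 2, ℓ 3} ^ j ⊔
    cmFil I (Ideal.span {ℓ 2, ℓ 3}) (j + 1) ≤ cmFil I (Ideal.span {ℓ 2, ℓ 3}) j :=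
  sup_le (F.isPrimaryTo.pow_le_fil j) (F.isPrimaryTo.fil_succ_le j)

/-- The degree of the divisor `D_j` is the difference of the degrees of `𝓛_j` and `𝓛₁ ^ j`. -/
theorem hasRankDegree_divisor {j : ℕ} (hj : j < d) :
    HasRankDegree (cmFil I (Ideal.span {ℓ 2, ℓ 3}) j)
      (cmFil I (Ideal.span {ℓ 2, ℓ 3}) 1 ^ j ⊔ cmFil I (Ideal.span {ℓ 2, ℓ 3}) (j + 1)) 0
      (δ j - j * ((e : ℤ) - 1)) := by
  rw [F.isPrimaryTo.fil_one]
  filter_upwards [F.degree j hj, hilb_pow_sup_fil F.coords F.isPrimaryTo F.relation F.ne_zero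
    F.not_pow_le hj] with n h1 h2
  rw [gradedDim_eq_sub (F.sup_le_fil j)]
  push_cast
  linarith

theorem sum_divisor (hd : 2 ≤ d) : ∑ j ∈ Finset.Icc 2 (d - 1), (δ j - j * ((e : ℤ) - 1)) +
    ((e : ℤ) - 1) * (d.choose 2 : ℤ) = ∑ j ∈ Finset.range d, δ j := by
  have h1 : ∑ j ∈ Finset.Icc 2 (d - 1), (δ j - j * ((e : ℤ) - 1)) =
      ∑ j ∈ Finset.range d, (δ j - j * ((e : ℤ) - 1)) := by
    refine Finset.sum_subset (fun j hj => ?_) fun j hj hj' => ?_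
    · rw [Finset.mem_Icc] at hj
      rw [Finset.mem_range]
      omega
    · rw [Finset.mem_Icc] at hj'
      rw [Finset.mem_range] at hj
      obtain rfl | rfl : j = 0 ∨ j = 1 := by omega
      · rw [F.degree_zero hd]; simp
      · rw [F.degree_one hd]; simp
  have h2 : (∑ j ∈ Finset.range d, (j : ℤ)) = (d.choose 2 : ℤ) := by
    rw [Nat.choose_two_right, ← Finset.sum_range_id]
    push_cast
    rfl
  rw [h1, Finset.sum_sub_distrib, ← Finset.sum_mul, h2]
  ring

/-- The product of `ℓ₂ ^ (d - 2)` and the equation of `C₂` vanishes on `C`, but not on `L_d`. -/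
theorem le_of_sections_eq (hd : 2 ≤ d) {l : ℕ}
    (hsec : piece I (l + d - 1) = piece (Ideal.span {ℓ 2, ℓ 3} ^ d) (l + d - 1)) :
    (l : ℤ) ≤ (e : ℤ) - 1 := by
  by_contra hlt
  have hel : e ≤ l := by omega
  have c := F.coords
  have h2 : ℓ 2 ∈ Ideal.span {ℓ 2, ℓ 3} := Ideal.subset_span (by simp)
  set H := lineExtend ℓ f * ℓ 2 - lineExtend ℓ g * ℓ 3 with hH
  have hHh : H.IsHomogeneous (e + 1) :=
    ((c.extend_isHomogeneous F.relation.left_isHomogeneous).mul (c.isHomogeneous 2)).sub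
      ((c.extend_isHomogeneous F.relation.right_isHomogeneous).mul (c.isHomogeneous 3))
  have hHL : H ∈ Ideal.span {ℓ 2, ℓ 3} :=
    sub_mem (Ideal.mul_mem_left _ _ h2) (Ideal.mul_mem_left _ _ (Ideal.subset_span (by simp)))
  have h1 : ℓ 2 ^ (d - 2) * (H * ℓ 1 ^ (l - e)) ∈ piece I (l + d - 1) := by
    constructor
    · have h3 := F.isPrimaryTo.mul_mem_fil F.relation.mem (Ideal.pow_mem_pow h2 (d - 2))
      rw [show 2 + (d - 2) = d by omega, F.isPrimaryTo.fil_eq_of_pow_le F.pow_le] at h3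
      have h4 := Ideal.mul_mem_right (ℓ 1 ^ (l - e)) _ h3
      change _ ∈ I
      convert h4 using 1
      rw [hH]
      ring
    · have h3 := ((c.isHomogeneous 2).pow (d - 2)).mul
        (hHh.mul ((c.isHomogeneous 1).pow (l - e)))
      rw [one_mul, one_mul, show d - 2 + (e + 1 + (l - e)) = l + d - 1 by omega] at h3
      exact h3
  rw [hsec] at h1
  have h3 : ℓ 2 ^ (d - 2) * (H * ℓ 1 ^ (l - e)) ∈ Ideal.span {ℓ 2, ℓ 3} ^ (d - 2 + 1 + 1) := by
    rw [show d - 2 + 1 + 1 = d by omega]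
    exact h1.1
  rcases c.mem_or_mem_of_mul_mem (Ideal.pow_mem_pow h2 (d - 2))
    (by rw [pow_one]; exact Ideal.mul_mem_right _ _ hHL) h3 with h4 | h4
  · exact c.two_pow_notMem _ h4
  · rcases c.mem_or_mem_of_mul_mem (i := 1) (j := 0) (by rwa [pow_one])
      (by rw [pow_zero, Ideal.one_eq_top]; trivial) h4 with h5 | h5
    · exact c.extend_notMem F.ne_zero (c.mem_of_relation_three h5)
    · rw [zero_add, pow_one] at h5
      exact c.one_notMem_line (c.line_isPrime.mem_of_pow_mem _ h5)

end RankOneFiltration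

/-! ### Tangent spaces and quasiprimitivity -/

/-- The derivative of `f` at the point `p` in the direction `v`. -/
def dirDeriv (p v : Fin 4 → k) (f : S k) : k := ∑ i, eval p (pderiv i f) * v i

theorem mem_coneTangentSpace {I : Ideal (S k)} {p v : Fin 4 → k} :
    v ∈ coneTangentSpace I p ↔ ∀ f ∈ I, dirDeriv p v f = 0 := Iff.rfl

theorem dirDeriv_add (p v : Fin 4 → k) (f g : S k) :
    dirDeriv p v (f + g) = dirDeriv p v f + dirDeriv p v g := by
  simp only [dirDeriv, map_add, add_mul, Finset.sum_add_distrib]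

theorem dirDeriv_sub (p v : Fin 4 → k) (f g : S k) :
    dirDeriv p v (f - g) = dirDeriv p v f - dirDeriv p v g := by
  simp only [dirDeriv, map_sub, sub_mul, Finset.sum_sub_distrib]

theorem dirDeriv_mul (p v : Fin 4 → k) (f g : S k) :
    dirDeriv p v (f * g) = eval p f * dirDeriv p v g + eval p g * dirDeriv p v f := by
  simp only [dirDeriv, Derivation.leibniz, smul_eq_mul, map_add, map_mul, Finset.mul_sum]
  rw [← Finset.sum_add_distrib]
  exact Finset.sum_congr rfl fun i _ => by ring

theorem dirDeriv_of_isHomogeneous_one (p v : Fin 4 → k) {f : S k} (hf : f.IsHomogeneous 1) :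
    dirDeriv p v f = eval v f := by
  have h1 : f ∈ homogeneousSubmodule (Fin 4) k 1 := hf
  rw [homogeneousSubmodule_one_eq_span_X] at h1
  clear hf
  induction h1 using Submodule.span_induction with
  | mem x hx =>
    obtain ⟨j, rfl⟩ := hx
    simp [dirDeriv, pderiv_X, Pi.single_apply]
  | zero => simp [dirDeriv]
  | add x y _ _ hx hy => rw [dirDeriv_add, hx, hy, map_add]
  | smul a x _ hx =>
    rw [smul_eq_C_mul, dirDeriv_mul, hx]
    simp [dirDeriv]

theorem dirDeriv_of_mem_sq {L : Ideal (S k)} {p : Fin 4 → k} (hp : ∀ f ∈ L, eval p f = 0)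
    (v : Fin 4 → k) {q : S k} (hq : q ∈ L ^ 2) : dirDeriv p v q = 0 := by
  rw [pow_two] at hq
  refine Submodule.mul_induction_on hq ?_ ?_
  · intro a ha b hb
    rw [dirDeriv_mul, hp a ha, hp b hb, zero_mul, zero_mul, add_zero]
  · intro a b ha hb
    rw [dirDeriv_add, ha, hb, add_zero]

theorem eval_smul_of_isHomogeneous {σ : Type*} {f : MvPolynomial σ k} {n : ℕ}
    (hf : f.IsHomogeneous n) (a : k) (x : σ → k) : eval (a • x) f = a ^ n * eval x f := by
  rw [eval_eq, eval_eq, Finset.mul_sum]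
  refine Finset.sum_congr rfl fun d hd => ?_
  have h1 : d.degree = n := by
    by_contra hne
    exact (mem_support_iff.1 hd) (hf.coeff_eq_zero hne)
  simp only [Pi.smul_apply, smul_eq_mul, mul_pow, Finset.prod_mul_distrib,
    Finset.prod_pow_eq_pow_sum]
  rw [← Finsupp.degree_apply, h1]
  ring

namespace Coords

variable {ℓ τ : Fin 4 → S k} (c : Coords ℓ τ)
include c

theorem exists_point (t : Fin 4 → k) : ∃ v : Fin 4 → k, ∀ i, eval v (ℓ i) = t i :=
  ⟨fun i => eval t (τ i), fun i => by
    have h1 := c.lift_apply t i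
    have h2 : coordsLift τ t = aeval fun i => eval t (τ i) := by
      simp only [coordsLift, aeval_eq_eval]
    rw [h2] at h1
    simpa [aeval_eq_eval] using h1⟩

theorem point_ext {x y : Fin 4 → k} (hxy : ∀ i, eval x (ℓ i) = eval y (ℓ i)) : x = y := by
  have h1 : (aeval x : S k →ₐ[k] k) = aeval y := c.hom_ext fun i => by
    simpa [aeval_eq_eval] using hxy i
  ext i
  simpa using DFunLike.congr_fun h1 (X i)

theorem finite_zeros [IsAlgClosed k] {Q : S k} {n : ℕ} (hQ : Q.IsHomogeneous n)
    (hQL : Q ∉ Ideal.span {ℓ 2, ℓ 3}) :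
    {p ∈ points (Ideal.span {ℓ 2, ℓ 3}) | eval p.rep Q = 0}.Finite := by
  classical
  set q := lineRestrict τ Q with hq
  have hq0 : q ≠ 0 := fun h0 => hQL ((c.mem_line_iff Q).2 h0)
  have hqh : q.IsHomogeneous n := c.restrict_isHomogeneous hQ
  -- The dehomogenization of the restriction of `Q` to the line.
  let r : Polynomial k := aeval ![Polynomial.X, 1] q
  have hr : ∀ a : k, r.eval a = eval ![a, 1] q := by
    intro a
    have h1 : ((Polynomial.aeval a).comp (aeval ![Polynomial.X, 1]) :
        MvPolynomial (Fin 2) k →ₐ[k] k) = aeval ![a, 1] := by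
      apply MvPolynomial.algHom_ext
      intro i
      fin_cases i <;> simp
    have h2 := DFunLike.congr_fun h1 q
    rw [aeval_eq_eval] at h2
    exact h2
  have hscale : ∀ a b : k, b ≠ 0 → eval ![a, b] q = b ^ n * r.eval (a / b) := by
    intro a b hb
    rw [hr, ← eval_smul_of_isHomogeneous hqh]
    congr 2
    ext i
    fin_cases i
    · simp [mul_div_cancel₀ _ hb]
    · simp
  have hr0 : r ≠ 0 := by
    intro h0
    have hinf : Infinite k := IsAlgClosed.instInfinite
    have h1 : q * X 1 = 0 := by
      apply MvPolynomial.funext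
      intro x
      rw [map_mul, eval_X, map_zero]
      by_cases hx : x 1 = 0
      · rw [hx, mul_zero]
      · have h2 := hscale (x 0) (x 1) hx
        rw [h0, Polynomial.eval_zero, mul_zero] at h2
        have h3 : (![x 0, x 1] : Fin 2 → k) = x := by
          ext i
          fin_cases i <;> rfl
        rw [h3] at h2
        rw [h2, zero_mul]
    exact hq0 ((mul_eq_zero.1 h1).resolve_right (X_ne_zero 1))
  have heval : ∀ x : Fin 4 → k, eval x (ℓ 2) = 0 → eval x (ℓ 3) = 0 →
      eval x Q = eval ![eval x (ℓ 0), eval x (ℓ 1)] q := by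
    intro x h2 h3
    have h1 : (aeval x : S k →ₐ[k] k) =
        (aeval ![eval x (ℓ 0), eval x (ℓ 1)]).comp (lineRestrict τ) := by
      apply c.hom_ext
      intro i
      rw [AlgHom.comp_apply, aeval_eq_eval, aeval_eq_eval]
      fin_cases i
      · simp [c.restrict_zero]
      · simp [c.restrict_one]
      · simp [c.restrict_two, h2]
      · simp [c.restrict_three, h3]
    have h4 := DFunLike.congr_fun h1 Q
    rw [AlgHom.comp_apply, aeval_eq_eval, aeval_eq_eval] at h4
    exact h4
  -- A point of the line is determined by its affine coordinate, where `none` stands for infinity.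
  let φ : ℙ k (Fin 4 → k) → Option k := fun p =>
    if eval p.rep (ℓ 1) = 0 then none else some (eval p.rep (ℓ 0) / eval p.rep (ℓ 1))
  have hm2 : ∀ p ∈ points (Ideal.span {ℓ 2, ℓ 3}), eval p.rep (ℓ 2) = 0 := fun p hp =>
    hp _ (Ideal.subset_span (by simp))
  have hm3 : ∀ p ∈ points (Ideal.span {ℓ 2, ℓ 3}), eval p.rep (ℓ 3) = 0 := fun p hp =>
    hp _ (Ideal.subset_span (by simp))
  have hzero : ∀ p ∈ points (Ideal.span {ℓ 2, ℓ 3}), eval p.rep (ℓ 1) = 0 →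
      eval p.rep (ℓ 0) ≠ 0 := by
    intro p hp h1 h0
    apply p.rep_nonzero
    refine c.point_ext fun i => ?_
    have hz : eval (0 : Fin 4 → k) (ℓ i) = 0 := by
      have := eval_smul_of_isHomogeneous (c.isHomogeneous i) 0 p.rep
      simpa using this
    rw [hz]
    fin_cases i
    · exact h0
    · exact h1
    · exact hm2 p hp
    · exact hm3 p hp
  have hprop : ∀ p ∈ points (Ideal.span {ℓ 2, ℓ 3}), ∀ p' ∈ points (Ideal.span {ℓ 2, ℓ 3}),
      ∀ a : k, eval p.rep (ℓ 0) = a * eval p'.rep (ℓ 0) →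
      eval p.rep (ℓ 1) = a * eval p'.rep (ℓ 1) → p = p' := by
    intro p hp p' hp' a h0 h1
    rw [← p.mk_rep, ← p'.mk_rep, Projectivization.mk_eq_mk_iff']
    refine ⟨a, c.point_ext fun i => ?_⟩
    rw [eval_smul_of_isHomogeneous (c.isHomogeneous i), pow_one]
    fin_cases i
    · exact h0.symm
    · exact h1.symm
    · exact (by rw [hm2 p hp, hm2 p' hp', mul_zero] : a * eval p'.rep (ℓ 2) = eval p.rep (ℓ 2))
    · exact (by rw [hm3 p hp, hm3 p' hp', mul_zero] : a * eval p'.rep (ℓ 3) = eval p.rep (ℓ 3))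
  refine Set.Finite.of_finite_image (f := φ) ?_ ?_
  · refine (Set.Finite.insert none
      ((r.roots.toFinset.finite_toSet).image some)).subset ?_
    rintro _ ⟨p, ⟨hp, hpQ⟩, rfl⟩
    by_cases h1 : eval p.rep (ℓ 1) = 0
    · left
      simp [φ, h1]
    · right
      refine ⟨eval p.rep (ℓ 0) / eval p.rep (ℓ 1), ?_, by simp [φ, h1]⟩
      rw [heval _ (hm2 p hp) (hm3 p hp), hscale _ _ h1] at hpQ
      rw [Finset.mem_coe, Multiset.mem_toFinset, Polynomial.mem_roots hr0]
      exact (mul_eq_zero.1 hpQ).resolve_left (pow_ne_zero _ h1)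
  · rintro p ⟨hp, -⟩ p' ⟨hp', -⟩ hpp
    simp only [φ] at hpp
    by_cases h1 : eval p.rep (ℓ 1) = 0 <;> by_cases h1' : eval p'.rep (ℓ 1) = 0
    · refine hprop p hp p' hp' (eval p.rep (ℓ 0) / eval p'.rep (ℓ 0)) ?_ ?_
      · rw [div_mul_cancel₀ _ (hzero p' hp' h1')]
      · rw [h1, h1', mul_zero]
    · simp [h1, h1'] at hpp
    · simp [h1, h1'] at hpp
    · rw [if_neg h1, if_neg h1', Option.some_inj] at hpp
      refine hprop p hp p' hp' (eval p.rep (ℓ 1) / eval p'.rep (ℓ 1)) ?_ ?_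
      · field_simp at hpp ⊢
        rw [hpp]
      · rw [div_mul_cancel₀ _ h1']

variable {I : Ideal (S k)} {a b : S k} {p : Fin 4 → k}

theorem dirDeriv_relation (hp : ∀ f ∈ Ideal.span {ℓ 2, ℓ 3}, eval p f = 0) (v : Fin 4 → k) :
    dirDeriv p v (a * ℓ 2 - b * ℓ 3) =
      eval p a * eval v (ℓ 2) - eval p b * eval v (ℓ 3) := by
  rw [dirDeriv_sub, dirDeriv_mul, dirDeriv_mul, hp (ℓ 2) (Ideal.subset_span (by simp)),
    hp (ℓ 3) (Ideal.subset_span (by simp)), dirDeriv_of_isHomogeneous_one _ _ (c.isHomogeneous 2),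
    dirDeriv_of_isHomogeneous_one _ _ (c.isHomogeneous 3)]
  ring

/-- The tangent space at a point of the line where a multiple of the conormal relation belongs to
`I` modulo `L ^ 2` is the hyperplane defined by the relation. -/
theorem finrank_coneTangentSpace_eq_three
    (hI : I ≤ Ideal.span {ℓ 2, ℓ 3} ^ 2 ⊔ Ideal.span {a * ℓ 2 - b * ℓ 3})
    (hp : ∀ f ∈ Ideal.span {ℓ 2, ℓ 3}, eval p f = 0) {t : S k} (ht : eval p t ≠ 0)
    (htH : t * (a * ℓ 2 - b * ℓ 3) ∈ I ⊔ Ideal.span {ℓ 2, ℓ 3} ^ 2)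
    (hab : eval p a ≠ 0 ∨ eval p b ≠ 0) :
    Module.finrank k (coneTangentSpace I p) = 3 := by
  set H := a * ℓ 2 - b * ℓ 3 with hH
  have hHL : eval p H = 0 := hp _ (sub_mem (Ideal.mul_mem_left _ _ (Ideal.subset_span (by simp)))
    (Ideal.mul_mem_left _ _ (Ideal.subset_span (by simp))))
  let φ : (Fin 4 → k) →ₗ[k] k := Fintype.linearCombination k fun i => eval p (pderiv i H)
  have hφ : ∀ v, φ v = dirDeriv p v H := by
    intro v
    simp only [φ, Fintype.linearCombination_apply, dirDeriv, smul_eq_mul]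
    exact Finset.sum_congr rfl fun i _ => mul_comm _ _
  have hker : coneTangentSpace I p = LinearMap.ker φ := by
    ext v
    rw [mem_coneTangentSpace, LinearMap.mem_ker, hφ]
    constructor
    · intro hv
      obtain ⟨x, hx, q, hq, hxq⟩ := Submodule.mem_sup.1 htH
      have h1 := congrArg (dirDeriv p v) hxq
      rw [dirDeriv_add, hv x hx, dirDeriv_of_mem_sq hp v hq, dirDeriv_mul, hHL, zero_mul,
        add_zero, add_zero] at h1
      exact (mul_eq_zero.1 h1.symm).resolve_left ht
    · intro hv f hf
      obtain ⟨q, hq, y, hy, rfl⟩ := Submodule.mem_sup.1 (hI hf)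
      obtain ⟨s, rfl⟩ := Ideal.mem_span_singleton'.1 hy
      rw [dirDeriv_add, dirDeriv_of_mem_sq hp v hq, dirDeriv_mul, hHL, hv]
      ring
  have hsurj : LinearMap.range φ = ⊤ := by
    refine LinearMap.range_eq_top.2 (LinearMap.surjective fun h0 => ?_)
    rcases hab with hab | hab
    · obtain ⟨v, hv⟩ := c.exists_point ![0, 0, 1, 0]
      have h1 := hφ v
      rw [h0, hH, c.dirDeriv_relation hp, hv, hv] at h1
      apply hab
      simpa using h1.symm
    · obtain ⟨v, hv⟩ := c.exists_point ![0, 0, 0, 1]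
      have h1 := hφ v
      rw [h0, hH, c.dirDeriv_relation hp, hv, hv] at h1
      apply hab
      simpa using h1.symm
  have h1 := LinearMap.finrank_range_add_finrank_ker φ
  rw [hsurj, finrank_top, Module.finrank_self, ← hker, Module.finrank_fin_fun] at h1
  omega

/-- Conversely, at a point of the line where the tangent space is not the whole space, a multiple of
the conormal relation belongs to `I` modulo `L ^ 2`. -/
theorem exists_of_finrank_coneTangentSpace_ne_four
    (hIh : I.IsHomogeneous (homogeneousSubmodule (Fin 4) k))
    (hLh : (Ideal.span {ℓ 2, ℓ 3}).IsHomogeneous (homogeneousSubmodule (Fin 4) k)) {e : ℕ}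
    (hH : (a * ℓ 2 - b * ℓ 3).IsHomogeneous e)
    (hI : I ≤ Ideal.span {ℓ 2, ℓ 3} ^ 2 ⊔ Ideal.span {a * ℓ 2 - b * ℓ 3})
    (hp : ∀ f ∈ Ideal.span {ℓ 2, ℓ 3}, eval p f = 0)
    (hrank : Module.finrank k (coneTangentSpace I p) ≠ 4) :
    (eval p a ≠ 0 ∨ eval p b ≠ 0) ∧ ∃ (n : ℕ) (t : S k), t.IsHomogeneous n ∧ eval p t ≠ 0 ∧
      t * (a * ℓ 2 - b * ℓ 3) ∈ I ⊔ Ideal.span {ℓ 2, ℓ 3} ^ 2 := by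
  have hne : coneTangentSpace I p ≠ ⊤ := by
    intro h0
    rw [h0, finrank_top, Module.finrank_fin_fun] at hrank
    exact hrank rfl
  obtain ⟨v, hv⟩ : ∃ v, v ∉ coneTangentSpace I p := by
    by_contra! hall
    exact hne (Submodule.eq_top_iff'.2 hall)
  rw [mem_coneTangentSpace] at hv
  push Not at hv
  obtain ⟨f, hf, hfv⟩ := hv
  obtain ⟨q, hq, y, hy, rfl⟩ := Submodule.mem_sup.1 (hI hf)
  obtain ⟨s, rfl⟩ := Ideal.mem_span_singleton'.1 hy
  have hHL : eval p (a * ℓ 2 - b * ℓ 3) = 0 :=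
    hp _ (sub_mem (Ideal.mul_mem_left _ _ (Ideal.subset_span (by simp)))
      (Ideal.mul_mem_left _ _ (Ideal.subset_span (by simp))))
  rw [dirDeriv_add, dirDeriv_of_mem_sq hp v hq, dirDeriv_mul, hHL, zero_mul, add_zero, zero_add,
    c.dirDeriv_relation hp] at hfv
  refine ⟨?_, ?_⟩
  · by_contra! h0
    rw [h0.1, h0.2] at hfv
    simp at hfv
  · have hs : eval p s ≠ 0 := left_ne_zero_of_mul hfv
    obtain ⟨n, hn⟩ : ∃ n, eval p (homogeneousComponent n s) ≠ 0 := by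
      by_contra! hall
      apply hs
      rw [← sum_homogeneousComponent s, map_sum]
      exact Finset.sum_eq_zero fun i _ => hall i
    refine ⟨n, _, homogeneousComponent_isHomogeneous n s, hn, ?_⟩
    have h1 : s * (a * ℓ 2 - b * ℓ 3) ∈ I ⊔ Ideal.span {ℓ 2, ℓ 3} ^ 2 := by
      rw [← add_sub_cancel_left q (s * (a * ℓ 2 - b * ℓ 3))]
      exact sub_mem (Ideal.mem_sup_left hf) (Ideal.mem_sup_right hq)
    have h2 := component_mem
      (Ideal.IsHomogeneous.sup hIh (isHomogeneous_pow hLh 2)) h1 (n + e)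
    rwa [mul_comm, homogeneousComponent_mul_left hH, mul_comm] at h2

end Coords

/-- A multiple line all of whose filtration quotients have rank one is quasiprimitive. -/
theorem RankOneFiltration.isQuasiprimitive [IsAlgClosed k] {C : (P3 k).IdealSheafData} {d e : ℕ}
    {ℓ τ : Fin 4 → S k} {f g : MvPolynomial (Fin 2) k} {δ : ℕ → ℤ}
    (F : RankOneFiltration (homIdeal C) d e ℓ τ f g δ)
    (hL : supportIdeal C = Ideal.span {ℓ 2, ℓ 3}) : IsQuasiprimitive C := by
  have c := F.coords
  have h := F.isPrimaryTo
  obtain ⟨s, hs, hsH⟩ := h.mem_fil.1 F.relation.mem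
  obtain ⟨n, hn⟩ : ∃ n, homogeneousComponent n s ∉ Ideal.span {ℓ 2, ℓ 3} := by
    by_contra! hall
    exact hs ((mem_iff_homogeneousComponent_mem h.line_isHomogeneous s).2 hall)
  set H := lineExtend ℓ f * ℓ 2 - lineExtend ℓ g * ℓ 3 with hH
  have hHh : H.IsHomogeneous (e + 1) :=
    ((c.extend_isHomogeneous F.relation.left_isHomogeneous).mul (c.isHomogeneous 2)).sub
      ((c.extend_isHomogeneous F.relation.right_isHomogeneous).mul (c.isHomogeneous 3))
  have htH : homogeneousComponent n s * H ∈ homIdeal C ⊔ Ideal.span {ℓ 2, ℓ 3} ^ 2 := by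
    have h2 := component_mem
      (Ideal.IsHomogeneous.sup h.isHomogeneous (isHomogeneous_pow h.line_isHomogeneous 2)) hsH
      (n + (e + 1))
    rwa [mul_comm, homogeneousComponent_mul_left hHh, mul_comm] at h2
  have hQ := (homogeneousComponent_isHomogeneous n s).mul
    (c.extend_isHomogeneous F.relation.right_isHomogeneous)
  have hQL : homogeneousComponent n s * lineExtend ℓ g ∉ Ideal.span {ℓ 2, ℓ 3} := fun hmem =>
    (c.line_isPrime.mem_or_mem hmem).elim hn (c.extend_notMem F.ne_zero)
  refine (c.finite_zeros hQ hQL).subset ?_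
  rintro p ⟨hp, hemb⟩
  rw [hL] at hp
  refine ⟨hp, ?_⟩
  by_contra hne
  rw [map_mul] at hne
  apply hemb
  rw [embDim, c.finrank_coneTangentSpace_eq_three ((h.le_fil 2).trans F.relation.le) hp
    (left_ne_zero_of_mul hne) htH (Or.inr (right_ne_zero_of_mul hne))]

/-! ### Primitive multiple lines -/

/-- If the annihilator of `J / E` has the irrelevant ideal as its radical, then `J` and `E` agree in
large degrees. -/
theorem eventually_piece_le {J E : Ideal (S k)}
    (hE : E.IsHomogeneous (homogeneousSubmodule (Fin 4) k))
    (hrad : ∀ i, (X i : S k) ∈ (E.colon (J : Set (S k))).radical) :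
    ∀ᶠ n in atTop, piece J n ≤ piece E n := by
  classical
  obtain ⟨M, hM⟩ := Ideal.exists_pow_le_of_le_radical_of_fg
    (I := idealOfVars (Fin 4) k) (J := E.colon (J : Set (S k)))
    (Ideal.span_le.2 (by rintro _ ⟨i, rfl⟩; exact hrad i)) (IsNoetherian.noetherian _)
  obtain ⟨T, rfl⟩ : J.FG := IsNoetherian.noetherian J
  refine eventually_atTop.2 ⟨M + T.sup totalDegree + 1, fun n hn x hx => ⟨?_, hx.2⟩⟩
  obtain ⟨a, -, hax⟩ := Submodule.mem_span_finset.1 hx.1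
  -- The coefficients `a t` may be truncated in degrees `≥ M`, where they annihilate `J / E`.
  let b : S k → S k := fun t => ∑ i ∈ Finset.range M, homogeneousComponent i (a t)
  have hb : ∀ t, a t - b t ∈ E.colon (Submodule.span (S k) (T : Set (S k)) : Set (S k)) := by
    intro t
    refine hM ((mem_pow_idealOfVars_iff' M _).2 fun m hm => ?_)
    rw [coeff_sub, coeff_sum]
    simp only [coeff_homogeneousComponent]
    rw [Finset.sum_ite_eq, if_pos (Finset.mem_range.2 hm), sub_self]
  have hdiff : x - ∑ t ∈ T, b t * t ∈ E := by
    rw [← hax, ← Finset.sum_sub_distrib]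
    refine sum_mem fun t ht => ?_
    have h1 := Submodule.mem_colon.1 (hb t) t (Submodule.subset_span ht)
    rw [smul_eq_mul, sub_mul] at h1
    exact h1
  have hzero : homogeneousComponent n (∑ t ∈ T, b t * t) = 0 := by
    rw [map_sum]
    refine Finset.sum_eq_zero fun t ht => homogeneousComponent_eq_zero _ _ ?_
    have h1 : (b t).totalDegree ≤ M := by
      refine totalDegree_finsetSum_le fun i hi => ?_
      exact (homogeneousComponent_isHomogeneous i (a t)).totalDegree_le.trans
        (Finset.mem_range.1 hi).le
    have h2 : t.totalDegree ≤ T.sup totalDegree := Finset.le_sup (f := totalDegree) ht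
    have h3 := totalDegree_mul (b t) t
    omega
  have h1 := component_mem hE hdiff n
  rw [map_sub, hzero, sub_zero, homogeneousComponent_of_isHomogeneous hx.2] at h1
  exact h1

section primitive

variable {I L : Ideal (S k)} (h : IsPrimaryTo I L) {u v f g : S k} (hL : L = Ideal.span {u, v})
  (hrel : f * u - g * v ∈ cmFil I L 2) (hg : g ∉ L)

include h hL hrel hg in
/-- Where `t g` is invertible, `I` contains an element that vanishes on `C₂` to first order, and
then `ℐ_{C_j} = ℐ_C + ℐ_L ^ j`. -/
theorem exists_pow_mul_mem {t : S k} (ht : t * (f * u - g * v) ∈ I ⊔ L ^ 2) {j : ℕ}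
    (hne : ∀ i < j, ¬ L ^ i ≤ cmFil I L (i + 1)) :
    ∃ N : ℕ, ∀ F ∈ cmFil I L j, (t * g) ^ N * F ∈ I ⊔ L ^ j := by
  have hu : u ∈ L := hL ▸ Ideal.subset_span (by simp)
  have hK : ∀ i m, ∀ x ∈ I ⊔ L ^ i, ∀ y ∈ Ideal.span {u, v} ^ m, x * y ∈ I ⊔ L ^ (i + m) := by
    intro i m x hx y hy
    rw [← hL] at hy
    obtain ⟨a, ha, b, hb, rfl⟩ := Submodule.mem_sup.1 hx
    rw [add_mul, pow_add]
    exact Submodule.add_mem_sup (I.mul_mem_right y ha) (Ideal.mul_mem_mul hb hy)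
  have ht' : (t * f) * u - (t * g) * v ∈ I ⊔ L ^ 2 := by
    convert ht using 1
    ring
  have key : ∀ i ≤ j, ∃ N : ℕ, ∀ F ∈ cmFil I L j, (t * g) ^ N * F ∈ I ⊔ L ^ i := by
    intro i hi
    induction i with
    | zero =>
      refine ⟨0, fun F _ => Ideal.mem_sup_right ?_⟩
      rw [pow_zero L, Ideal.one_eq_top]
      trivial
    | succ i ih =>
      obtain ⟨N, hN⟩ := ih (by omega)
      refine ⟨i + N, fun F hF => ?_⟩
      obtain ⟨r, hr, G, hG, hrG⟩ := Submodule.mem_sup.1 (hN F hF)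
      have hanti : cmFil I L j ≤ cmFil I L (i + 1) :=
        antitone_nat_of_succ_le h.fil_succ_le hi
      have hGJ : G ∈ cmFil I L (i + 1) := by
        rw [← add_sub_cancel_left r G, hrG]
        exact sub_mem (Ideal.mul_mem_left _ _ (hanti hF)) (h.le_fil _ hr)
      have hG' := hG
      rw [hL] at hG'
      obtain ⟨a, ha⟩ := exists_pow_mul_sub_mem_filtration (K := fun i => I ⊔ L ^ i) hK ht' i hG'
      have h1 : a * u ^ i ∈ cmFil I L (i + 1) := by
        have h2 := sub_mem (Ideal.mul_mem_left _ ((t * g) ^ i) hGJ) (h.sup_le_fil _ ha)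
        rwa [sub_sub_cancel] at h2
      have haL : a ∈ L := by
        by_contra haL
        exact pow_notMem_fil h hL hrel hg (hne i (by omega)) (h.fil_saturated haL h1)
      have h3 : a * u ^ i ∈ L ^ (i + 1) := by
        rw [pow_succ' L]
        exact Ideal.mul_mem_mul haL (Ideal.pow_mem_pow hu i)
      have h4 : (t * g) ^ i * G ∈ I ⊔ L ^ (i + 1) := by
        rw [← sub_add_cancel ((t * g) ^ i * G) (a * u ^ i)]
        exact add_mem ha (Ideal.mem_sup_right h3)
      rw [pow_add (t * g), mul_assoc, ← hrG, mul_add]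
      exact add_mem (Ideal.mem_sup_left (I.mul_mem_left _ hr)) h4
  exact key j le_rfl

end primitive

/-- On a primitive multiple line, the cokernel of `𝓛₁ ^ j → 𝓛_j` has empty support. -/
theorem RankOneFiltration.X_mem_radical [IsAlgClosed k] {C : (P3 k).IdealSheafData} {d e : ℕ}
    {ℓ τ : Fin 4 → S k} {f g : MvPolynomial (Fin 2) k} {δ : ℕ → ℤ}
    (F : RankOneFiltration (homIdeal C) d e ℓ τ f g δ)
    (hL : supportIdeal C = Ideal.span {ℓ 2, ℓ 3}) (hC : IsPrimitive C) {j : ℕ} (hj : j < d)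
    (i : Fin 4) :
    (X i : S k) ∈ ((Ideal.span {ℓ 2, ℓ 3} ^ j ⊔
      cmFil (homIdeal C) (Ideal.span {ℓ 2, ℓ 3}) (j + 1)).colon
        (cmFil (homIdeal C) (Ideal.span {ℓ 2, ℓ 3}) j : Set (S k))).radical := by
  have c := F.coords
  have h := F.isPrimaryTo
  rw [← vanishingIdeal_zeroLocus_eq_radical (K := k), mem_vanishingIdeal_iff]
  intro x hx
  rw [mem_zeroLocus_iff] at hx
  rw [aeval_X]
  by_contra hxi
  have hx0 : x ≠ 0 := fun h0 => hxi (by rw [h0]; rfl)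
  have hcolon : ∀ s : S k, (∀ y ∈ cmFil (homIdeal C) (Ideal.span {ℓ 2, ℓ 3}) j,
      s * y ∈ homIdeal C ⊔ Ideal.span {ℓ 2, ℓ 3} ^ j) → eval x s = 0 := by
    intro s hs
    have h1 := hx s (Submodule.mem_colon.2 fun y hy =>
      sup_le (le_sup_of_le_right (h.le_fil _)) le_sup_left (hs y hy))
    rwa [aeval_eq_eval] at h1
  have hxL : ∀ s ∈ Ideal.span {ℓ 2, ℓ 3}, eval x s = 0 := by
    intro s hs
    have h1 := hcolon (s ^ j) fun y _ =>
      Ideal.mem_sup_right (Ideal.mul_mem_right _ _ (Ideal.pow_mem_pow hs j))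
    rw [map_pow] at h1
    exact eq_zero_of_pow_eq_zero h1
  let p : ℙ k (Fin 4 → k) := Projectivization.mk k x hx0
  obtain ⟨a, ha⟩ : ∃ a : kˣ, a • x = p.rep := Projectivization.exists_smul_eq_mk_rep k x hx0
  have hscale : ∀ {n : ℕ} {s : S k}, s.IsHomogeneous n →
      eval p.rep s = (a : k) ^ n * eval x s := by
    intro n s hs
    rw [← ha]
    exact eval_smul_of_isHomogeneous hs (a : k) x
  have hp : ∀ s ∈ Ideal.span {ℓ 2, ℓ 3}, eval p.rep s = 0 := by
    intro s hs
    obtain ⟨y, z, rfl⟩ := Ideal.mem_span_pair.1 hs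
    rw [map_add, map_mul, map_mul, hscale (c.isHomogeneous 2), hscale (c.isHomogeneous 3),
      hxL _ (Ideal.subset_span (by simp)), hxL (ℓ 3) (Ideal.subset_span (by simp))]
    ring
  have hemb := hC p (by rw [hL]; exact hp)
  have hHh : (lineExtend ℓ f * ℓ 2 - lineExtend ℓ g * ℓ 3).IsHomogeneous (e + 1) :=
    ((c.extend_isHomogeneous F.relation.left_isHomogeneous).mul (c.isHomogeneous 2)).sub
      ((c.extend_isHomogeneous F.relation.right_isHomogeneous).mul (c.isHomogeneous 3))
  obtain ⟨hfg, n, t, hth, htp, ht⟩ := c.exists_of_finrank_coneTangentSpace_ne_four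
    h.isHomogeneous h.line_isHomogeneous hHh ((h.le_fil 2).trans F.relation.le) hp (by
      unfold embDim at hemb
      omega)
  have htx : eval x t ≠ 0 := fun h0 => htp (by rw [hscale hth, h0, mul_zero])
  rcases hfg with hf | hg
  · have hfx : eval x (lineExtend ℓ f) ≠ 0 := fun h0 => hf (by
      rw [hscale (c.extend_isHomogeneous F.relation.left_isHomogeneous), h0, mul_zero])
    have hneg : lineExtend ℓ g * ℓ 3 - lineExtend ℓ f * ℓ 2 =
        -(lineExtend ℓ f * ℓ 2 - lineExtend ℓ g * ℓ 3) := by ring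
    obtain ⟨N, hN⟩ := exists_pow_mul_mem h (u := ℓ 3) (v := ℓ 2) (f := lineExtend ℓ g)
      (g := lineExtend ℓ f) (congrArg Ideal.span (Set.pair_comm _ _))
      (by rw [hneg]; exact neg_mem F.relation.mem) (fun hmem => hfx (hxL _ hmem)) (t := t)
      (by rw [hneg, mul_neg]; exact neg_mem ht) (j := j)
      fun i hi => F.not_pow_le i (hi.trans hj)
    have h1 := hcolon _ hN
    rw [map_pow, map_mul] at h1
    exact mul_ne_zero htx hfx (eq_zero_of_pow_eq_zero h1)
  · have hgx : eval x (lineExtend ℓ g) ≠ 0 := fun h0 => hg (by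
      rw [hscale (c.extend_isHomogeneous F.relation.right_isHomogeneous), h0, mul_zero])
    obtain ⟨N, hN⟩ := exists_pow_mul_mem h (u := ℓ 2) (v := ℓ 3) rfl F.relation.mem
      (c.extend_notMem F.ne_zero) ht (j := j) fun i hi => F.not_pow_le i (hi.trans hj)
    have h1 := hcolon _ hN
    rw [map_pow, map_mul] at h1
    exact mul_ne_zero htx hgx (eq_zero_of_pow_eq_zero h1)

/-- On a primitive multiple line, the divisors `D_j` are zero. -/
theorem RankOneFiltration.divisor_eq_zero [IsAlgClosed k] {C : (P3 k).IdealSheafData} {d e : ℕ}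
    {ℓ τ : Fin 4 → S k} {f g : MvPolynomial (Fin 2) k} {δ : ℕ → ℤ}
    (F : RankOneFiltration (homIdeal C) d e ℓ τ f g δ)
    (hL : supportIdeal C = Ideal.span {ℓ 2, ℓ 3}) (hC : IsPrimitive C) {j : ℕ} (hj : j < d) :
    δ j - j * ((e : ℤ) - 1) = 0 := by
  have h := F.isPrimaryTo
  have hev := eventually_piece_le (Ideal.IsHomogeneous.sup
    (isHomogeneous_pow h.line_isHomogeneous j) (h.fil_isHomogeneous (j + 1)))
    (F.X_mem_radical hL hC hj)
  obtain ⟨n, h1, h2⟩ := (hev.and (F.hasRankDegree_divisor hj)).exists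
  rw [h.fil_one, gradedDim_eq_sub (F.sup_le_fil j), hilb, hilb,
    le_antisymm h1 (piece_mono (F.sup_le_fil j) n), sub_self] at h2
  push_cast at h2
  linarith

end SpaceCurve

end

theorem mainTheorem3 {k : Type u} [Field k] [IsAlgClosed k] (d l : ℕ) (hd : 2 ≤ d)
    (C : (SpaceCurve.P3 k).IdealSheafData) (hC : SpaceCurve.IsC d l C) :
    SpaceCurve.IsQuasiprimitive C ∧
    (∃ (a : ℤ) (b : ℕ → ℤ), SpaceCurve.HasType C d a b) ∧
    (∀ (a : ℤ) (b : ℕ → ℤ), SpaceCurve.HasType C d a b →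
      ((l : ℤ) ≤ a ∧ a ≤ (l : ℤ) + ((d - 2) / 3 : ℕ)) ∧
      (∑ j ∈ Finset.Icc 2 (d - 1), b j) + (a - (l : ℤ)) * (d.choose 2 : ℤ) = (d.choose 3 : ℤ) ∧
      (SpaceCurve.IsPrimitive C → d % 3 = 2 ∧ a = (l : ℤ) + ((d - 2) / 3 : ℕ))) := by
  obtain ⟨e, ℓ, τ, f, g, δ, hL, F, hsum⟩ := hC.exists_rankOneFiltration hd
  have hfil : ∀ j, SpaceCurve.filtrant C j =
      SpaceCurve.cmFil (SpaceCurve.homIdeal C) (Ideal.span {ℓ 2, ℓ 3}) j := by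
    intro j
    rw [← hL]
    rfl
  have hone := F.hasRankDegree_one hd
  have hdiv : ∀ j ∈ Finset.Icc 2 (d - 1), SpaceCurve.HasRankDegree (SpaceCurve.filtrant C j)
      (SpaceCurve.filtrant C 1 ^ j ⊔ SpaceCurve.filtrant C (j + 1)) 0
      (δ j - j * ((e : ℤ) - 1)) := by
    intro j hj
    rw [Finset.mem_Icc] at hj
    simp only [hfil]
    exact F.hasRankDegree_divisor (by omega)
  refine ⟨F.isQuasiprimitive hL, ⟨(e : ℤ) - 1, fun j => δ j - j * ((e : ℤ) - 1), ⟨?_, hdiv⟩⟩, ?_⟩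
  · simpa only [hfil] using hone
  · intro a b hab
    have ha : a = (e : ℤ) - 1 := by
      have h1 := hab.degree_one
      simp only [hfil] at h1
      exact SpaceCurve.hasRankDegree_unique h1 hone
    have hb : ∀ j ∈ Finset.Icc 2 (d - 1), b j = δ j - j * ((e : ℤ) - 1) := fun j hj =>
      SpaceCurve.hasRankDegree_unique (hab.degree_divisor j hj) (hdiv j hj)
    have hla : (l : ℤ) ≤ a := by
      rw [ha]
      refine F.le_of_sections_eq hd ?_
      rw [hC.sections_eq, hL]
    have heq : (∑ j ∈ Finset.Icc 2 (d - 1), b j) + (a - (l : ℤ)) * (d.choose 2 : ℤ) =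
        (d.choose 3 : ℤ) := by
      have h1 := F.sum_divisor hd
      rw [hsum, ← Finset.sum_congr rfl hb, ← ha] at h1
      linarith
    have hchoose : (d.choose 3 : ℤ) * 3 = (d.choose 2 : ℤ) * ((d - 2 : ℕ) : ℤ) := by
      exact_mod_cast Nat.choose_succ_right_eq d 2
    have hpos : (0 : ℤ) < (d.choose 2 : ℤ) := by
      exact_mod_cast Nat.choose_pos hd
    refine ⟨⟨hla, ?_⟩, heq, fun hprim => ?_⟩
    · have hnonneg : 0 ≤ ∑ j ∈ Finset.Icc 2 (d - 1), b j := Finset.sum_nonneg fun j hj =>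
        SpaceCurve.hasRankDegree_zero_nonneg (hab.degree_divisor j hj)
      have h1 : (d.choose 2 : ℤ) * ((a - l) * 3) ≤ (d.choose 2 : ℤ) * ((d - 2 : ℕ) : ℤ) := by
        rw [← hchoose]
        linarith
      have h2 := le_of_mul_le_mul_left h1 hpos
      omega
    · have hzero : ∑ j ∈ Finset.Icc 2 (d - 1), b j = 0 := Finset.sum_eq_zero fun j hj => by
        rw [hb j hj]
        rw [Finset.mem_Icc] at hj
        exact F.divisor_eq_zero hL hprim (by omega)
      have h1 : (d.choose 2 : ℤ) * ((a - l) * 3) = (d.choose 2 : ℤ) * ((d - 2 : ℕ) : ℤ) := by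
        rw [← hchoose]
        linarith
      have h2 := mul_left_cancel₀ hpos.ne' h1
      omega
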